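/- **Theorem 4.6 (Generalized quantum Capelli identity).** Let $n\ge 1$ and let $u$ and $p_{ij},q_{ij}$ ($1\le i,j\le n$) be nonzero complex numbers with $p_{ij}q_{ij}=u^2$ for $i<j$, $p_{ij}p_{ji}=q_{ij}q_{ji}=1$, $p_{ii}=q_{ii}=1$. Assume $u^2\neq\pm1$ and $[n]_{u^2}!\neq 0$, where $[m]_v=1+v+\dots+v^{m-1}$ and $[n]_v!=[1]_v\cdots[n]_v$. For a permutation $\sigma\in S_n$ and a family $a=(a_{ij})$ put $(-a)_\sigma=\prod_{i<j,\ \sigma_i>\sigma_j}(-a_{\sigma_j\sigma_i})$, and for a matrix $X$ over a $\mathbb C$-algebra put $\operatorname{rdet}_a(X)=\sum_\sigma(-a)_\sigma X_{1,\sigma_1}\cdots X_{n,\sigma_n}$ and $\operatorname{cdet}_a(X)=\sum_\sigma(-a)_\sigma X_{\sigma_1,1}\cdots X_{\sigma_n,n}$. Let $$R=u\sum_i e_{ii}\otimes e_{ii}+u^{-1}\sum_{i>j}p_{ji}\,e_{ii}\otimes e_{jj}+u^{-1}\sum_{i<j}q_{ij}\,e_{ii}\otimes e_{jj}+(u-u^{-1})\sum_{i>j}e_{ij}\otimes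 e_{ji},$$ $R^+=\mathsf PR\mathsf P$ with $\mathsf P$ the flip of $\mathbb C^n\otimes\mathbb C^n$, and $R^-=R^{-1}$. Let $GL_{p,u}(n)$ be the bialgebra generated by $t_{ij}$ ($1\le i,j\le n$) and the inverse of $\det_q(T):=\operatorname{rdet}_q(T)$, where $T=(t_{ij})$, with relations $RT_1T_2=T_2T_1R$ and coproduct $\Delta(t_{ij})=\sum_k t_{ik}\otimes t_{kj}$, counit $\varepsilon(t_{ij})=\delta_{ij}$; put $\det_p(T)=\operatorname{cdet}_p(T)$. Let $S(T)$ be the matrix of antipodes, $$S(t_{ij})=(-1)^{i-j}\frac{\prod_{l<i}q_{li}}{\prod_{l<j}q_{lj}}\ \xi^{\hat j}_{\hat i}\ \det\nolimits_q(T)^{-1},$$ where $\xi^{\hat j}_{\hat i}$ is the quantum row-minor of $T$ (with the parameters $q$ indexed by the remaining columns) obtained by deleting row $j$ and column $i$. Let $U_{p,u}(\mathfrak{gl}_n)$ be the algebra generated by $l^+_{ij}$ $(i\le j)$ and $l^-_{ij}$ $(i\ge j)$, the entries of an upper triangular matrix $L^+$ and a lower triangular matrix $L^-$, with relations $R^+L_1^\pm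 L_2^\pm=L_2^\pm L_1^\pm R^+$ and $R^+L_1^+L_2^-=L_2^-L_1^+R^+$. It is paired with $GL_{p,u}(n)$ by $(L_1^\pm,T_2)=R^\pm$, $(ab,\varphi)=(a\otimes b,\Delta(\varphi))$, $(l^{\pm}_{ij},\varphi\psi)=\sum_k(l^\pm_{ik},\varphi)(l^\pm_{kj},\psi)$, $(l^\pm_{ij},1)=\delta_{ij}$, and it acts on $GL_{p,u}(n)$ from the left by $a.\varphi=(\mathrm{id}\otimes a)\Delta(\varphi)$ and from the right by $\varphi.a=(a\otimes\mathrm{id})\Delta(\varphi)$; write $a^\circ$ for the operator $\varphi\mapsto\varphi.a$. For $\lambda\in\mathbb C^\times$ put $L(\lambda)=\lambda L^+-\lambda^{-1}L^-$, and let $\partial(\lambda)=(\partial_{ij}(\lambda))$ be the matrix of linear operators on $GL_{p,u}(n)$ given by $$\partial_{ij}(\lambda)\varphi=(u-u^{-1})^{-1}\sum_k\bigl(L_{jk}(\lambda).\varphi\bigr)\,S(t_{ki}),\qquad\text{i.e. } (u-u^{-1})\,\partial(\lambda)^t\varphi=(L(\lambda).\varphi)\,S(T).$$ Put $$c(x)=\sum_{\sigma,\tau\in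 S_n}(-p)_\sigma(-q)_\tau\,L_{\sigma_n\tau_n}(xu^{1-n})\cdots L_{\sigma_2\tau_2}(xu^{-1})L_{\sigma_1\tau_1}(x),\qquad d(x)=\frac{c(x)^\circ}{(u-u^{-1})^{n}\,[n]_{u^2}!}.$$ Then for every $x\in\mathbb C^\times$ one has the following identity of linear operators on $GL_{p,u}(n)$, in which $\det_p(T)$ acts by left multiplication and products of operators are compositions: $$d(xu^{n-1})=\prod_{i<j}p_{ij}\cdot\det\nolimits_p(T)\cdot\operatorname{rdet}_{p^{-1}}(\partial(x)),\qquad p^{-1}=(p_{ij}^{-1}).$$ -/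

import Mathlib

open scoped TensorProduct Kronecker

namespace QuantumGL

/-- `(-q)_k = ∏_{a < b, k_a > k_b} (-q_{k_b k_a})` for a word `k`; for a permutation `σ` this is
`(-1)^{l(σ)} ∏_{a < b, σ_a > σ_b} q_{σ_b σ_a}`. -/
noncomputable def invWeight {n m : ℕ} (q : Fin n → Fin n → ℂ) (k : Fin m → Fin n) : ℂ :=
  ∏ ab : Fin m × Fin m with ab.1 < ab.2 ∧ k ab.2 < k ab.1, -q (k ab.2) (k ab.1)

/-- The quantum row-determinant `∑_σ (-q)_σ t_{1,σ_1} ⋯ t_{n,σ_n}`. -/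
noncomputable def rdet {n : ℕ} {A : Type*} [Ring A] [Algebra ℂ A] (q : Fin n → Fin n → ℂ)
    (T : Matrix (Fin n) (Fin n) A) : A :=
  ∑ σ : Equiv.Perm (Fin n), invWeight q σ • (List.ofFn fun i => T i (σ i)).prod

/-- The quantum column-determinant `∑_σ (-p)_σ t_{σ_1,1} ⋯ t_{σ_n,n}`. -/
noncomputable def cdet {n : ℕ} {A : Type*} [Ring A] [Algebra ℂ A] (p : Fin n → Fin n → ℂ)
    (T : Matrix (Fin n) (Fin n) A) : A :=
  ∑ σ : Equiv.Perm (Fin n), invWeight p σ • (List.ofFn fun i => T (σ i) i).prod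

/-- The quantum row-minor with rows `r_1 < ⋯ < r_m` and columns `c_1 < ⋯ < c_m`. -/
noncomputable def minor {n m : ℕ} {A : Type*} [Ring A] [Algebra ℂ A] (q : Fin n → Fin n → ℂ)
    (T : Matrix (Fin n) (Fin n) A) (r c : Fin m → Fin n) : A :=
  ∑ σ : Equiv.Perm (Fin m), invWeight q (fun a => c (σ a)) •
    (List.ofFn fun a => T (r a) (c (σ a))).prod

/-- Parameters `p_ij`, `q_ij`, `u` with `p_ij q_ij = u²` for `i < j` and `u² ≠ -1`, extended to all
pairs of indices by `p_ij p_ji = q_ij q_ji = 1`, `p_ii = q_ii = 1`. -/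
structure Param (n : ℕ) where
  u : ℂ
  p : Fin n → Fin n → ℂ
  q : Fin n → Fin n → ℂ
  u_ne_zero : u ≠ 0
  u_sq_ne : u ^ 2 ≠ -1
  p_mul_q : ∀ i j, i < j → p i j * q i j = u ^ 2
  p_mul_p : ∀ i j, p i j * p j i = 1
  q_mul_q : ∀ i j, q i j * q j i = 1
  p_self : ∀ i, p i i = 1
  q_self : ∀ i, q i i = 1

/-- `End(ℂⁿ ⊗ ℂⁿ) ⊗ A`; the entry at `((a, b), (c, d))` is the coefficient of `e_ac ⊗ e_bd`. -/
abbrev Mat2 (n : ℕ) (A : Type*) := Matrix (Fin n × Fin n) (Fin n × Fin n) A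

/-- The multiparameter `R`-matrix. -/
noncomputable def Param.R {n : ℕ} (P : Param n) : Mat2 n ℂ :=
  P.u • ∑ i, Matrix.single i i 1 ⊗ₖ Matrix.single i i 1
  + P.u⁻¹ • ∑ i, ∑ j with j < i, P.p j i • (Matrix.single i i 1 ⊗ₖ Matrix.single j j 1)
  + P.u⁻¹ • ∑ i, ∑ j with i < j, P.q i j • (Matrix.single i i 1 ⊗ₖ Matrix.single j j 1)
  + (P.u - P.u⁻¹) • ∑ i, ∑ j with j < i, Matrix.single i j 1 ⊗ₖ Matrix.single j i 1

/-- `R⁺ = P R P` with `P` the flip. -/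
noncomputable def Param.Rplus {n : ℕ} (P : Param n) : Mat2 n ℂ :=
  P.R.submatrix Prod.swap Prod.swap

/-- `R⁻ = R⁻¹`. -/
noncomputable def Param.Rminus {n : ℕ} (P : Param n) : Mat2 n ℂ := P.R⁻¹

section RMatrix

variable {n : ℕ}

/-- Kronecker delta. -/
def dl (a b : Fin n) : ℂ := if a = b then 1 else 0

/-- Matrices of the shape `∑ D_ab e_aa ⊗ e_bb + ∑ h_ab e_ab ⊗ e_ba`. -/
def xm (D h : Fin n → Fin n → ℂ) : Mat2 n ℂ := fun ab cd =>
  D ab.1 ab.2 * (dl ab.1 cd.1 * dl ab.2 cd.2) + h ab.1 ab.2 * (dl ab.1 cd.2 * dl ab.2 cd.1)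

noncomputable def Param.Dp (P : Param n) (a b : Fin n) : ℂ :=
  if a = b then P.u else if b < a then P.u⁻¹ * P.p b a else P.u⁻¹ * P.q a b

noncomputable def Param.hp (P : Param n) (a b : Fin n) : ℂ := if b < a then P.u - P.u⁻¹ else 0

noncomputable def Param.Dm (P : Param n) (a b : Fin n) : ℂ :=
  if a = b then P.u⁻¹ else if b < a then P.u * (P.p b a)⁻¹ else P.u * (P.q a b)⁻¹

noncomputable def Param.hm (P : Param n) (a b : Fin n) : ℂ := if b < a then P.u⁻¹ - P.u else 0

theorem Param.p_ne (P : Param n) (i j : Fin n) : P.p i j ≠ 0 := by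
  intro h; have := P.p_mul_p i j; simp [h] at this

theorem Param.q_ne (P : Param n) (i j : Fin n) : P.q i j ≠ 0 := by
  intro h; have := P.q_mul_q i j; simp [h] at this

theorem Param.q_eq (P : Param n) {i j : Fin n} (h : i < j) : P.q i j = P.u ^ 2 / P.p i j := by
  rw [eq_div_iff (P.p_ne i j), mul_comm]; exact P.p_mul_q i j h

theorem Param.R_eq (P : Param n) : P.R = xm P.Dp P.hp := by
  have h2 : ∀ x y : Fin n, ∀ i j, (Matrix.single i j (1:ℂ)) x y = if i = x then dl j y else 0 := by
    intro x y i j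
    simp only [Matrix.single_apply, dl]; split_ifs <;> simp_all
  ext ⟨a, b⟩ ⟨c, d⟩
  simp only [Param.R, Matrix.add_apply, Matrix.smul_apply, Matrix.sum_apply, Finset.sum_filter,
    apply_ite (fun M : Mat2 n ℂ => M (a,b) (c,d)), Matrix.zero_apply, Matrix.kroneckerMap_apply,
    h2, smul_eq_mul, xm, Param.Dp, Param.hp]
  simp only [ite_mul, mul_ite, mul_zero, zero_mul, ← ite_and]
  have e1 : ∀ f : Fin n → Fin n → ℂ, ∀ (r : Fin n → Fin n → Prop) [DecidableRel r],
      (∑ i, ∑ j, if r i j ∧ j = b ∧ i = a then f i j else 0) = if r a b then f a b else 0 := by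
    intro f r _
    rw [Finset.sum_eq_single a, Finset.sum_eq_single b] <;> simp +contextual
  have e2 : (∑ i, if i = b ∧ i = a then dl i c * dl i d else 0) =
      if a = b then dl a c * dl b d else 0 := by
    rw [Finset.sum_eq_single a] <;> simp +contextual
  rw [e1 (fun i j => P.p j i * (dl i c * dl j d)) (fun i j => j < i),
    e1 (fun i j => P.q i j * (dl i c * dl j d)) (fun i j => i < j),
    e1 (fun i j => (dl j c * dl i d)) (fun i j => j < i), e2]
  rcases lt_trichotomy a b with h | h | h
  · simp [h, h.ne, h.not_gt]; ring
  · subst h; simp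
  · simp [h, h.ne', h.not_gt]; ring

theorem sum_dl (a : Fin n) (g : Fin n → ℂ) : ∑ x, dl a x * g x = g a := by
  simp [dl]

theorem sum_xm (D h : Fin n → Fin n → ℂ) (a b : Fin n) (g : Fin n → Fin n → ℂ) :
    ∑ x, ∑ y, xm D h (a, b) (x, y) * g x y = D a b * g a b + h a b * g b a := by
  have h1 : ∀ x y, xm D h (a, b) (x, y) * g x y =
      dl a x * (dl b y * (D a b * g x y)) + dl b x * (dl a y * (h a b * g x y)) := by
    intro x y; simp only [xm]; ring
  simp_rw [h1, Finset.sum_add_distrib, ← Finset.mul_sum, sum_dl]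

theorem xm_mul (D h D' h' : Fin n → Fin n → ℂ) :
    xm D h * xm D' h' = xm (fun a b => D a b * D' a b + h a b * h' b a)
      (fun a b => D a b * h' a b + h a b * D' b a) := by
  ext ⟨a, b⟩ ⟨c, d⟩
  rw [Matrix.mul_apply, Fintype.sum_prod_type]
  rw [sum_xm D h a b (fun x y => xm D' h' (x, y) (c, d))]
  simp only [xm]; ring

theorem Param.R_mul (P : Param n) : P.R * xm P.Dm P.hm = 1 := by
  rw [P.R_eq, xm_mul]
  have hu := P.u_ne_zero
  ext ⟨a, b⟩ ⟨c, d⟩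
  have h1 : (1 : Mat2 n ℂ) (a, b) (c, d) = dl a c * dl b d := by
    simp [Matrix.one_apply, dl, ← ite_and, and_comm]
  rw [h1]
  simp only [xm, Param.Dp, Param.Dm, Param.hp, Param.hm]
  rcases lt_trichotomy a b with h | h | h
  · have := P.q_ne a b
    simp only [h, h.ne, h.not_gt, h.ne', if_true, if_false]; field_simp; ring
  · subst h; simp [hu]
  · have := P.p_ne b a
    have e := P.q_eq h
    simp only [h, h.ne', h.ne, h.not_gt, e, if_true, if_false]; field_simp; ring

theorem Param.Rminus_eq (P : Param n) : P.Rminus = xm P.Dm P.hm :=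
  Matrix.inv_eq_right_inv P.R_mul

theorem Param.isUnit_Rplus (P : Param n) : IsUnit P.Rplus := by
  have h : P.Rplus * (xm P.Dm P.hm).submatrix Prod.swap Prod.swap = 1 := by
    have := Matrix.submatrix_mul_equiv P.R (xm P.Dm P.hm) (Equiv.prodComm (Fin n) (Fin n))
      (Equiv.prodComm (Fin n) (Fin n)) (Equiv.prodComm (Fin n) (Fin n))
    rw [P.R_mul, Matrix.submatrix_one_equiv] at this
    exact this
  exact IsUnit.of_mul_eq_one _ h

theorem Param.Rplus_eq (P : Param n) :
    P.Rplus = xm (fun a b => P.Dp b a) (fun a b => P.hp b a) := by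
  ext ⟨a, b⟩ ⟨c, d⟩
  simp only [Param.Rplus, P.R_eq, Matrix.submatrix_apply, Prod.swap, xm]; ring

/-- `A₁₂ B₁₃ C₂₃ = C₂₃ B₁₃ A₁₂`, entrywise. -/
def YB (X Y Z : Mat2 n ℂ) : Prop := ∀ a b c d e f,
  ∑ x, ∑ y, ∑ z, X (a, b) (x, y) * Y (x, c) (d, z) * Z (y, z) (e, f) =
  ∑ x, ∑ y, ∑ z, Z (b, c) (y, z) * Y (a, z) (x, f) * X (x, y) (d, e)

theorem YB_xm_left (D1 h1 D2 h2 D3 h3 : Fin n → Fin n → ℂ) (a b c d e f : Fin n) :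
    ∑ x, ∑ y, ∑ z, xm D1 h1 (a, b) (x, y) * xm D2 h2 (x, c) (d, z) * xm D3 h3 (y, z) (e, f) =
    D1 a b * (D2 a c * dl a d * xm D3 h3 (b, c) (e, f) + h2 a c * dl c d * xm D3 h3 (b, a) (e, f)) +
    h1 a b * (D2 b c * dl b d * xm D3 h3 (a, c) (e, f) + h2 b c * dl c d * xm D3 h3 (a, b) (e, f))
    := by
  have h : ∀ x y, ∑ z, xm D2 h2 (x, c) (d, z) * xm D3 h3 (y, z) (e, f) =
      D2 x c * dl x d * xm D3 h3 (y, c) (e, f) + h2 x c * dl c d * xm D3 h3 (y, x) (e, f) := by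
    intro x y
    have h1 : ∀ z, xm D2 h2 (x, c) (d, z) * xm D3 h3 (y, z) (e, f) =
      dl c z * (D2 x c * dl x d * xm D3 h3 (y, z) (e, f)) +
      dl x z * (h2 x c * dl c d * xm D3 h3 (y, z) (e, f)) := by
      intro z; simp only [xm]; ring
    simp_rw [h1, Finset.sum_add_distrib, sum_dl]
  simp_rw [mul_assoc (xm D1 h1 _ _), ← Finset.mul_sum, h]
  rw [sum_xm D1 h1 a b (fun x y => D2 x c * dl x d * xm D3 h3 (y, c) (e, f) +
    h2 x c * dl c d * xm D3 h3 (y, x) (e, f))]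

theorem YB_xm_right (D1 h1 D2 h2 D3 h3 : Fin n → Fin n → ℂ) (a b c d e f : Fin n) :
    ∑ x, ∑ y, ∑ z, xm D3 h3 (b, c) (y, z) * xm D2 h2 (a, z) (x, f) * xm D1 h1 (x, y) (d, e) =
    D3 b c * (D2 a c * dl c f * xm D1 h1 (a, b) (d, e) + h2 a c * dl a f * xm D1 h1 (c, b) (d, e)) +
    h3 b c * (D2 a b * dl b f * xm D1 h1 (a, c) (d, e) + h2 a b * dl a f * xm D1 h1 (b, c) (d, e))
    := by
  have h : ∀ y z, ∑ x, xm D2 h2 (a, z) (x, f) * xm D1 h1 (x, y) (d, e) =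
      D2 a z * dl z f * xm D1 h1 (a, y) (d, e) + h2 a z * dl a f * xm D1 h1 (z, y) (d, e) := by
    intro y z
    have h1 : ∀ x, xm D2 h2 (a, z) (x, f) * xm D1 h1 (x, y) (d, e) =
      dl a x * (D2 a z * dl z f * xm D1 h1 (x, y) (d, e)) +
      dl z x * (h2 a z * dl a f * xm D1 h1 (x, y) (d, e)) := by
      intro x; simp only [xm]; ring
    simp_rw [h1, Finset.sum_add_distrib, sum_dl]
  have h' : ∀ y, ∑ x, ∑ z, xm D3 h3 (b, c) (y, z) * xm D2 h2 (a, z) (x, f) * xm D1 h1 (x, y) (d, e)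
    = ∑ z, xm D3 h3 (b, c) (y, z) * (D2 a z * dl z f * xm D1 h1 (a, y) (d, e) +
      h2 a z * dl a f * xm D1 h1 (z, y) (d, e)) := by
    intro y
    rw [Finset.sum_comm]
    simp_rw [← h, Finset.mul_sum, mul_assoc]
  rw [Finset.sum_comm]
  simp_rw [h']
  rw [sum_xm D3 h3 b c (fun y z => D2 a z * dl z f * xm D1 h1 (a, y) (d, e) +
      h2 a z * dl a f * xm D1 h1 (z, y) (d, e))]

theorem Param.Dp_lt (P : Param n) {a b : Fin n} (h : a < b) : P.Dp a b = P.u / P.p a b := by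
  have hu := P.u_ne_zero
  have := P.p_ne a b
  simp only [Param.Dp, h.ne, h.not_gt, if_false, P.q_eq h]; field_simp

theorem Param.Dp_gt (P : Param n) {a b : Fin n} (h : b < a) : P.Dp a b = P.u⁻¹ * P.p b a := by
  simp only [Param.Dp, h.ne', h, if_false, if_true]

theorem Param.Dp_self (P : Param n) (a : Fin n) : P.Dp a a = P.u := by simp [Param.Dp]

theorem Param.Dm_lt (P : Param n) {a b : Fin n} (h : a < b) : P.Dm a b = P.u⁻¹ * P.p a b := by
  have hu := P.u_ne_zero
  have := P.p_ne a b
  simp only [Param.Dm, h.ne, h.not_gt, if_false, P.q_eq h]; field_simp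

theorem Param.Dm_gt (P : Param n) {a b : Fin n} (h : b < a) : P.Dm a b = P.u / P.p b a := by
  simp only [Param.Dm, h.ne', h, if_false, if_true]; rfl

theorem Param.Dm_self (P : Param n) (a : Fin n) : P.Dm a a = P.u⁻¹ := by simp [Param.Dm]

theorem Param.hp_lt (P : Param n) {a b : Fin n} (h : a < b) : P.hp a b = 0 := by
  simp only [Param.hp, h.not_gt, if_false]

theorem Param.hp_gt (P : Param n) {a b : Fin n} (h : b < a) : P.hp a b = P.u - P.u⁻¹ := by
  simp only [Param.hp, h, if_true]

theorem Param.hp_self (P : Param n) (a : Fin n) : P.hp a a = 0 := by simp [Param.hp]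

theorem Param.hm_lt (P : Param n) {a b : Fin n} (h : a < b) : P.hm a b = 0 := by
  simp only [Param.hm, h.not_gt, if_false]

theorem Param.hm_gt (P : Param n) {a b : Fin n} (h : b < a) : P.hm a b = P.u⁻¹ - P.u := by
  simp only [Param.hm, h, if_true]

theorem Param.hm_self (P : Param n) (a : Fin n) : P.hm a a = 0 := by simp [Param.hm]

set_option maxHeartbeats 1600000 in
/-- All instances of the Yang–Baxter equation that are needed below. -/
theorem Param.yang_baxter (P : Param n) :
    YB P.R P.R P.R ∧ YB P.R (P.Rminus.submatrix Prod.swap Prod.swap)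
      (P.Rminus.submatrix Prod.swap Prod.swap) ∧
    YB P.Rplus P.Rplus P.Rplus ∧ YB P.Rplus P.Rminus P.Rminus ∧ YB P.Rplus P.Rplus P.Rminus := by
  have hu := P.u_ne_zero
  have hs : P.Rminus.submatrix Prod.swap Prod.swap =
      xm (fun a b => P.Dm b a) (fun a b => P.hm b a) := by
    ext ⟨a, b⟩ ⟨c, d⟩
    simp only [P.Rminus_eq, Matrix.submatrix_apply, Prod.swap, xm]; ring
  rw [hs, P.R_eq, P.Rplus_eq, P.Rminus_eq]
  refine ⟨?_, ?_, ?_, ?_, ?_⟩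
  all_goals
    intro a b c d e f
    rw [YB_xm_left, YB_xm_right]
    simp only [xm]
    have h1 := P.p_ne a b
    have h2 := P.p_ne b a
    have h3 := P.p_ne a c
    have h4 := P.p_ne c a
    have h5 := P.p_ne b c
    have h6 := P.p_ne c b
    rcases lt_trichotomy a b with h | h | h <;> rcases lt_trichotomy b c with h' | h' | h' <;>
    rcases lt_trichotomy a c with h'' | h'' | h'' <;>
    first
    | (exfalso; order)
    | (try subst h
       try subst h'
       try subst h''
       simp only [Param.Dp_self, Param.Dm_self, Param.hp_self, Param.hm_self, Param.Dp_lt,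
         Param.Dp_gt, Param.Dm_lt, Param.Dm_gt, Param.hp_lt, Param.hp_gt, Param.hm_lt, Param.hm_gt, *]
       field_simp <;> ring)

end RMatrix

section RTT

variable {n : ℕ} {A B : Type*} [Ring A] [Algebra ℂ A] [Ring B] [Algebra ℂ B]

/-- `T₁ = T ⊗ I`. -/
def leg1 (T : Matrix (Fin n) (Fin n) A) : Mat2 n A := T ⊗ₖ (1 : Matrix (Fin n) (Fin n) A)

/-- `T₂ = I ⊗ T`. -/
def leg2 (T : Matrix (Fin n) (Fin n) A) : Mat2 n A := (1 : Matrix (Fin n) (Fin n) A) ⊗ₖ T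

/-- The relation `R T₁ T₂ = T₂ T₁ R` for a matrix `T` over an algebra. -/
def Param.RTT (P : Param n) (T : Matrix (Fin n) (Fin n) A) : Prop :=
  P.R.map (algebraMap ℂ A) * leg1 T * leg2 T = leg2 T * leg1 T * P.R.map (algebraMap ℂ A)

theorem leg1_mul_leg2 (S T : Matrix (Fin n) (Fin n) A) (a b c d : Fin n) :
    (leg1 S * leg2 T) (a, b) (c, d) = S a c * T b d := by
  rw [Matrix.mul_apply, Fintype.sum_prod_type]
  simp [leg1, leg2, Matrix.one_apply]

theorem leg2_mul_leg1 (S T : Matrix (Fin n) (Fin n) A) (a b c d : Fin n) :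
    (leg2 S * leg1 T) (a, b) (c, d) = S b d * T a c := by
  rw [Matrix.mul_apply, Fintype.sum_prod_type]
  simp [leg1, leg2, Matrix.one_apply]

theorem map_mul_leg (X : Mat2 n ℂ) (S T : Matrix (Fin n) (Fin n) A) (a b c d : Fin n) :
    (X.map (algebraMap ℂ A) * leg1 S * leg2 T) (a, b) (c, d) =
      ∑ x, ∑ y, X (a, b) (x, y) • (S x c * T y d) := by
  rw [mul_assoc, Matrix.mul_apply, Fintype.sum_prod_type]
  simp [leg1_mul_leg2, Algebra.smul_def]

theorem leg_mul_map (X : Mat2 n ℂ) (S T : Matrix (Fin n) (Fin n) A) (a b c d : Fin n) :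
    (leg2 S * leg1 T * X.map (algebraMap ℂ A)) (a, b) (c, d) =
      ∑ x, ∑ y, X (x, y) (c, d) • (S b y * T a x) := by
  rw [Matrix.mul_apply, Fintype.sum_prod_type]
  simp [leg2_mul_leg1, Algebra.smul_def, Algebra.commutes]

theorem Param.RTT_iff (P : Param n) (T : Matrix (Fin n) (Fin n) A) :
    P.RTT T ↔ ∀ a b c d, ∑ x, ∑ y, P.R (a, b) (x, y) • (T x c * T y d) =
      ∑ x, ∑ y, P.R (x, y) (c, d) • (T b y * T a x) := by
  rw [Param.RTT, ← Matrix.ext_iff]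
  simp only [Prod.forall, map_mul_leg, leg_mul_map]

theorem sum_xm_smul (D h : Fin n → Fin n → ℂ) (a b : Fin n) (g : Fin n → Fin n → A) :
    ∑ x, ∑ y, xm D h (a, b) (x, y) • g x y = D a b • g a b + h a b • g b a := by
  simp [xm, dl, add_smul, Finset.sum_add_distrib, ite_and, mul_ite]

theorem sum_xm_smul' (D h : Fin n → Fin n → ℂ) (c d : Fin n) (g : Fin n → Fin n → A) :
    ∑ x, ∑ y, xm D h (x, y) (c, d) • g x y = D c d • g c d + h d c • g d c := by
  simp [xm, dl, add_smul, Finset.sum_add_distrib, ite_and, mul_ite]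

theorem Param.RTT_iff' (P : Param n) (T : Matrix (Fin n) (Fin n) A) :
    P.RTT T ↔ ∀ a b c d,
      P.Dp a b • (T a c * T b d) + P.hp a b • (T b c * T a d) =
      P.Dp c d • (T b d * T a c) + P.hp d c • (T b c * T a d) := by
  rw [P.RTT_iff, P.R_eq]
  simp only [sum_xm_smul (A := A) P.Dp P.hp _ _ (fun x y => T x _ * T y _),
    sum_xm_smul' (A := A) P.Dp P.hp _ _ (fun x y => T _ y * T _ x)]

theorem Param.RTT.map {P : Param n} {T : Matrix (Fin n) (Fin n) A} (h : P.RTT T) (f : A →ₐ[ℂ] B) :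
    P.RTT (T.map f) := by
  rw [P.RTT_iff'] at h ⊢
  intro a b c d
  simpa using congrArg f (h a b c d)

theorem Param.RTT.mul {P : Param n} {S T : Matrix (Fin n) (Fin n) A} (hS : P.RTT S) (hT : P.RTT T)
    (hc : ∀ i j k l, Commute (S i j) (T k l)) : P.RTT (S * T) := by
  have e1 : leg1 (S * T) = leg1 S * leg1 T := by
    ext ⟨a, b⟩ ⟨c, d⟩
    rw [Matrix.mul_apply, Fintype.sum_prod_type]
    simp [leg1, Matrix.one_apply, Matrix.mul_apply]
  have e2 : leg2 (S * T) = leg2 S * leg2 T := by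
    ext ⟨a, b⟩ ⟨c, d⟩
    rw [Matrix.mul_apply, Fintype.sum_prod_type]
    simp [leg2, Matrix.one_apply, Matrix.mul_apply]
  have e3 : leg1 T * leg2 S = leg2 S * leg1 T := by
    ext ⟨a, b⟩ ⟨c, d⟩
    rw [leg1_mul_leg2, leg2_mul_leg1, hc]
  have e4 : leg2 T * leg1 S = leg1 S * leg2 T := by
    ext ⟨a, b⟩ ⟨c, d⟩
    rw [leg1_mul_leg2, leg2_mul_leg1, hc]
  unfold Param.RTT at *
  set R := P.R.map (algebraMap ℂ A)
  calc R * leg1 (S * T) * leg2 (S * T) = R * leg1 S * (leg1 T * leg2 S) * leg2 T := by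
        rw [e1, e2]; noncomm_ring
    _ = (R * leg1 S * leg2 S) * leg1 T * leg2 T := by rw [e3]; noncomm_ring
    _ = leg2 S * leg1 S * (R * leg1 T * leg2 T) := by rw [hS]; noncomm_ring
    _ = leg2 S * (leg1 S * leg2 T) * leg1 T * R := by rw [hT]; noncomm_ring
    _ = leg2 (S * T) * leg1 (S * T) * R := by rw [← e4, e1, e2]; noncomm_ring

theorem rdet_map (q : Fin n → Fin n → ℂ) (T : Matrix (Fin n) (Fin n) A) (f : A →ₐ[ℂ] B) :
    f (rdet q T) = rdet q (T.map f) := by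
  simp only [rdet, map_sum, map_smul, map_list_prod, List.map_ofFn]; rfl

end RTT

section Det

variable {n : ℕ} {A B : Type*} [Ring A] [Algebra ℂ A] [Ring B] [Algebra ℂ B]

theorem prod_ofFn_split {m : ℕ} (a : Fin m) : ∃ pre post : (Fin (m + 1) → A) → A,
    (∀ f, (List.ofFn f).prod = pre f * (f a.castSucc * f a.succ) * post f) ∧
    ∀ f g, (∀ x, x ≠ a.castSucc → x ≠ a.succ → f x = g x) → pre f = pre g ∧ post f = post g := by
  induction m with
  | zero => exact a.elim0
  | succ m ih =>
    refine Fin.cases ?_ (fun b => ?_) a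
    · refine ⟨fun _ => 1, fun f => (List.ofFn fun i : Fin m => f i.succ.succ).prod, ?_, ?_⟩
      · intro f; simp [List.ofFn_succ, mul_assoc]
      · intro f g h
        refine ⟨rfl, ?_⟩
        have e : (fun i : Fin m => f i.succ.succ) = fun i : Fin m => g i.succ.succ := by
          funext i
          exact h _ (Fin.succ_ne_zero _) (fun e => Fin.succ_ne_zero _ (Fin.succ_injective _ e))
        show (List.ofFn fun i : Fin m => f i.succ.succ).prod = _
        rw [e]
    · obtain ⟨pre, post, h1, h2⟩ := ih b
      refine ⟨fun f => f 0 * pre (fun i => f i.succ), fun f => post (fun i => f i.succ), ?_, ?_⟩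
      · intro f
        rw [List.ofFn_succ, List.prod_cons, h1]
        simp [mul_assoc]
      · intro f g h
        have := h2 (fun i => f i.succ) (fun i => g i.succ) (fun x hx hx' => h _
          (by simpa [Fin.ext_iff] using hx) (by simpa [Fin.ext_iff] using hx'))
        refine ⟨?_, this.2⟩
        show f 0 * pre _ = g 0 * pre _
        rw [this.1, h 0 (by simp [Fin.ext_iff]) (by simp [Fin.ext_iff])]

theorem invWeight_swap (P : Param n) {m : ℕ} (a : Fin m) (k : Fin (m + 1) → Fin n)
    (hk : k a.castSucc ≠ k a.succ) :
    invWeight P.q (k ∘ Equiv.swap a.castSucc a.succ) =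
      -P.q (k a.castSucc) (k a.succ) * invWeight P.q k := by
  set s := Equiv.swap a.castSucc a.succ with hs
  let f : Fin n → Fin n → ℂ := fun i j => if j < i then -P.q j i else 1
  have hw : ∀ l : Fin (m + 1) → Fin n, invWeight P.q l =
      ∏ ab : Fin (m + 1) × Fin (m + 1) with ab.1 < ab.2, f (l ab.1) (l ab.2) := by
    intro l
    rw [invWeight, ← Finset.filter_filter, Finset.prod_filter]
  have hlt : a.castSucc < a.succ := Fin.castSucc_lt_succ
  rw [hw, hw]
  have h1 : ∏ ab : Fin (m + 1) × Fin (m + 1) with ab.1 < ab.2, f ((k ∘ s) ab.1) ((k ∘ s) ab.2) =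
      ∏ ab : Fin (m + 1) × Fin (m + 1) with s ab.1 < s ab.2, f (k ab.1) (k ab.2) := by
    refine Finset.prod_nbij' (fun ab => (s ab.1, s ab.2)) (fun ab => (s ab.1, s ab.2)) ?_ ?_ ?_ ?_ ?_
    all_goals simp [hs]
  have key : ∀ x y : Fin (m + 1), ¬ (x = a.castSucc ∧ y = a.succ) →
      ¬ (x = a.succ ∧ y = a.castSucc) → (s x < s y ↔ x < y) := by
    intro x y h h'
    simp only [hs, Equiv.swap_apply_def]
    split_ifs <;> simp only [Fin.lt_def, Fin.ext_iff, Fin.val_castSucc, Fin.val_succ] at * <;> omega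
  have h2 : (Finset.univ.filter fun ab : Fin (m + 1) × Fin (m + 1) => s ab.1 < s ab.2) =
      insert (a.succ, a.castSucc) ((Finset.univ.filter
        fun ab : Fin (m + 1) × Fin (m + 1) => ab.1 < ab.2).erase (a.castSucc, a.succ)) := by
    ext ⟨x, y⟩
    by_cases hx : x = a.castSucc ∧ y = a.succ
    · obtain ⟨rfl, rfl⟩ := hx
      simp [hs, hlt.not_gt, hlt.ne]
    by_cases hx' : x = a.succ ∧ y = a.castSucc
    · obtain ⟨rfl, rfl⟩ := hx'
      simp [hs, hlt]
    have := key x y hx hx'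
    simp [this, hx, hx']
  have h3 : (a.castSucc, a.succ) ∈ (Finset.univ.filter
      fun ab : Fin (m + 1) × Fin (m + 1) => ab.1 < ab.2) := by simp [hlt]
  rw [h1, h2, Finset.prod_insert (by simp [hlt.not_gt]), ← Finset.mul_prod_erase _ _ h3, ← mul_assoc]
  congr 1
  simp only [f]
  rcases lt_or_gt_of_ne hk with h | h
  · simp [h, h.not_gt]
  · simp [h, h.not_gt, P.q_mul_q]

theorem Param.q_gt (P : Param n) {i j : Fin n} (h : j < i) : P.q i j = P.p j i / P.u ^ 2 := by
  have hu := P.u_ne_zero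
  have h1 := P.p_ne j i
  have h2 := P.q_mul_q i j
  rw [P.q_eq h] at h2
  field_simp at h2 ⊢
  exact h2

theorem Param.RTT.rel {P : Param n} {T : Matrix (Fin n) (Fin n) A} (hT : P.RTT T) (i j c d : Fin n)
    (hij : i ≠ j) (hcd : c ≠ d) :
    T j c * T i d - P.q c d • (T j d * T i c) = -P.q i j • (T i c * T j d - P.q c d • (T i d * T j c))
    := by
  rw [P.RTT_iff'] at hT
  wlog h : i < j generalizing i j
  · have := this j i hij.symm (lt_of_le_of_ne (not_lt.1 h) hij.symm)
    rw [this, smul_smul, neg_mul_neg, P.q_mul_q, one_smul]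
  wlog h' : c < d generalizing c d
  · have := this d c hcd.symm (lt_of_le_of_ne (not_lt.1 h') hcd.symm)
    have e1 := P.q_ne c d
    have e2 : P.q d c = (P.q c d)⁻¹ := eq_inv_of_mul_eq_one_right (P.q_mul_q c d)
    rw [e2] at this
    linear_combination (norm := (match_scalars <;> field_simp <;> ring)) (-P.q c d) • this
  have h1 := hT i j c d
  have h2 := hT i j d c
  have hu := P.u_ne_zero
  have h3 := P.p_ne i j
  have h4 := P.p_ne c d
  rw [P.Dp_lt h, P.Dp_lt h', P.hp_lt h, P.hp_gt h', zero_smul, add_zero] at h1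
  rw [P.Dp_lt h, P.Dp_gt h', P.hp_lt h, P.hp_lt h', zero_smul, add_zero, add_zero] at h2
  rw [P.q_eq h, P.q_eq h']
  linear_combination (norm := (match_scalars <;> field_simp <;> ring)) P.u • h1 + (-(P.u * (P.u ^ 2 / P.p c d))) • h2

theorem Param.RTT.rel_self {P : Param n} {T : Matrix (Fin n) (Fin n) A} (hT : P.RTT T)
    (i c d : Fin n) (hcd : c ≠ d) : T i c * T i d = P.q c d • (T i d * T i c) := by
  rw [P.RTT_iff'] at hT
  have h1 := hT i i c d
  have hu := P.u_ne_zero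
  have h4 := P.p_ne c d
  rcases lt_or_gt_of_ne hcd with h | h
  · rw [P.Dp_self, P.hp_self, P.Dp_lt h, P.hp_gt h, zero_smul, add_zero] at h1
    rw [P.q_eq h]
    linear_combination (norm := (match_scalars <;> field_simp <;> ring)) P.u • h1
  · rw [P.Dp_self, P.hp_self, P.Dp_gt h, P.hp_lt h, zero_smul, add_zero, add_zero] at h1
    rw [P.q_gt h]
    linear_combination (norm := (match_scalars <;> field_simp <;> ring)) (P.u⁻¹) • h1

end Det

section RowDet

variable {n : ℕ} {A B : Type*} [Ring A] [Algebra ℂ A] [Ring B] [Algebra ℂ B]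

/-- Row determinant of the matrix whose `i`-th row is row `k_i` of `T`. -/
noncomputable def rowDet (q : Fin n → Fin n → ℂ) (T : Matrix (Fin n) (Fin n) A)
    (k : Fin n → Fin n) : A :=
  ∑ σ : Equiv.Perm (Fin n), invWeight q σ • (List.ofFn fun i => T (k i) (σ i)).prod

theorem two_rowDet {m : ℕ} (P : Param (m + 1)) (T : Matrix (Fin (m + 1)) (Fin (m + 1)) A)
    (a : Fin m) (k l : Fin (m + 1) → Fin (m + 1))
    (hkl : ∀ x, x ≠ a.castSucc → x ≠ a.succ → k x = l x) :
    ∃ pre post : Equiv.Perm (Fin (m + 1)) → A,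
      ((2 : ℂ) • rowDet P.q T k = ∑ σ : Equiv.Perm (Fin (m + 1)), invWeight P.q σ • (pre σ *
        (T (k a.castSucc) (σ a.castSucc) * T (k a.succ) (σ a.succ) -
          P.q (σ a.castSucc) (σ a.succ) • (T (k a.castSucc) (σ a.succ) * T (k a.succ) (σ a.castSucc)))
        * post σ)) ∧
      ((2 : ℂ) • rowDet P.q T l = ∑ σ : Equiv.Perm (Fin (m + 1)), invWeight P.q σ • (pre σ *
        (T (l a.castSucc) (σ a.castSucc) * T (l a.succ) (σ a.succ) -
          P.q (σ a.castSucc) (σ a.succ) • (T (l a.castSucc) (σ a.succ) * T (l a.succ) (σ a.castSucc)))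
        * post σ)) := by
  obtain ⟨pre, post, h1, h2⟩ := prod_ofFn_split (A := A) a
  have key : ∀ k' : Fin (m + 1) → Fin (m + 1), (∀ x, x ≠ a.castSucc → x ≠ a.succ → k' x = k x) →
    (2 : ℂ) • rowDet P.q T k' = ∑ σ : Equiv.Perm (Fin (m + 1)), invWeight P.q σ •
        (pre (fun i => T (k i) (σ i)) *
        (T (k' a.castSucc) (σ a.castSucc) * T (k' a.succ) (σ a.succ) -
          P.q (σ a.castSucc) (σ a.succ) • (T (k' a.castSucc) (σ a.succ) * T (k' a.succ) (σ a.castSucc)))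
        * post (fun i => T (k i) (σ i))) := by
    intro k' hk'
    rw [two_smul]
    nth_rewrite 2 [rowDet]
    rw [← Equiv.sum_comp (Equiv.mulRight (Equiv.swap a.castSucc a.succ)), rowDet,
      ← Finset.sum_add_distrib]
    refine Finset.sum_congr rfl fun σ _ => ?_
    have hw := invWeight_swap P a σ (σ.injective.ne (Fin.castSucc_lt_succ (i := a)).ne)
    have hw' : invWeight P.q (Equiv.mulRight (Equiv.swap a.castSucc a.succ) σ) =
      invWeight P.q (σ ∘ Equiv.swap a.castSucc a.succ) := rfl
    rw [hw', hw, h1, h1]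
    have e1 := h2 (fun i => T (k' i) (σ i)) (fun i => T (k i) (σ i)) (by
      intro x hx hx'; simp only [hk' x hx hx'])
    have e2 := h2 (fun i => T (k' i) (Equiv.mulRight (Equiv.swap a.castSucc a.succ) σ i))
      (fun i => T (k i) (σ i)) (by
      intro x hx hx'; simp only [hk' x hx hx', Equiv.coe_mulRight, Equiv.Perm.mul_apply,
        Equiv.swap_apply_of_ne_of_ne hx hx'])
    rw [e1.1, e1.2, e2.1, e2.2]
    simp only [Equiv.coe_mulRight, Equiv.Perm.mul_apply, Equiv.swap_apply_left,
      Equiv.swap_apply_right, mul_sub, sub_mul, smul_sub, mul_smul_comm, smul_mul_assoc, smul_smul]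
    rw [neg_mul, neg_smul, mul_comm, ← sub_eq_add_neg]
  exact ⟨_, _, key k (fun _ _ _ => rfl), key l (fun x hx hx' => (hkl x hx hx').symm)⟩

theorem rowDet_eq_zero {m : ℕ} {P : Param (m + 1)} {T : Matrix (Fin (m + 1)) (Fin (m + 1)) A}
    (hT : P.RTT T) (a : Fin m) (k : Fin (m + 1) → Fin (m + 1)) (h : k a.castSucc = k a.succ) :
    rowDet P.q T k = 0 := by
  obtain ⟨pre, post, h1, -⟩ := two_rowDet P T a k k (fun _ _ _ => rfl)
  have : (2 : ℂ) • rowDet P.q T k = 0 := by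
    rw [h1]
    refine Finset.sum_eq_zero fun σ _ => ?_
    rw [h, hT.rel_self _ _ _ (σ.injective.ne (Fin.castSucc_lt_succ (i := a)).ne)]
    simp
  simpa using this

theorem rowDet_swap {m : ℕ} {P : Param (m + 1)} {T : Matrix (Fin (m + 1)) (Fin (m + 1)) A}
    (hT : P.RTT T) (a : Fin m) (k : Fin (m + 1) → Fin (m + 1)) (h : k a.castSucc ≠ k a.succ) :
    rowDet P.q T (k ∘ Equiv.swap a.castSucc a.succ) =
      -P.q (k a.castSucc) (k a.succ) • rowDet P.q T k := by
  obtain ⟨pre, post, h1, h2⟩ := two_rowDet P T a k (k ∘ Equiv.swap a.castSucc a.succ)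
    (fun x hx hx' => by simp [Equiv.swap_apply_of_ne_of_ne hx hx'])
  have : (2 : ℂ) • rowDet P.q T (k ∘ Equiv.swap a.castSucc a.succ) =
      (2 : ℂ) • (-P.q (k a.castSucc) (k a.succ) • rowDet P.q T k) := by
    rw [smul_comm, h1, h2, Finset.smul_sum]
    refine Finset.sum_congr rfl fun σ _ => ?_
    simp only [Function.comp_apply, Equiv.swap_apply_left, Equiv.swap_apply_right]
    rw [hT.rel _ _ _ _ h (σ.injective.ne (Fin.castSucc_lt_succ (i := a)).ne), mul_smul_comm,
      smul_mul_assoc, smul_comm]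
  exact smul_right_injective A (two_ne_zero (α := ℂ)) this

theorem invWeight_id (q : Fin n → Fin n → ℂ) : invWeight q (fun i : Fin n => i) = 1 := by
  rw [invWeight, Finset.prod_eq_one]
  intro ab h
  simp only [Finset.mem_filter] at h
  exact absurd h.2.1 h.2.2.not_gt

theorem rowDet_perm {P : Param n} {T : Matrix (Fin n) (Fin n) A} (hT : P.RTT T)
    (σ : Equiv.Perm (Fin n)) : rowDet P.q T σ = invWeight P.q σ • rdet P.q T := by
  have h1 : rowDet P.q T (1 : Equiv.Perm (Fin n)) =
      invWeight P.q (1 : Equiv.Perm (Fin n)) • rdet P.q T := by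
    rw [show ⇑(1 : Equiv.Perm (Fin n)) = fun i => i from rfl, invWeight_id, one_smul]; rfl
  cases n with
  | zero => rw [Subsingleton.elim σ 1]; exact h1
  | succ m =>
    have hσ : σ ∈ Submonoid.closure (Set.range fun i : Fin m => Equiv.swap i.castSucc i.succ) := by
      rw [Equiv.Perm.mclosure_swap_castSucc_succ]; trivial
    induction hσ using Submonoid.closure_induction_right with
    | one => exact h1
    | mul_right τ _ s hs ih =>
      obtain ⟨a, rfl⟩ := hs
      have hne := τ.injective.ne (Fin.castSucc_lt_succ (i := a)).ne
      rw [Equiv.Perm.coe_mul, rowDet_swap hT a τ hne, ih, invWeight_swap P a τ hne, smul_smul]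

theorem rowDet_not_injective {P : Param n} {T : Matrix (Fin n) (Fin n) A} (hT : P.RTT T)
    (k : Fin n → Fin n) (hk : ¬ Function.Injective k) : rowDet P.q T k = 0 := by
  cases n with
  | zero => exact absurd (fun x => x.elim0) hk
  | succ m =>
    have h1 : ∀ (a : Fin m) (k : Fin (m + 1) → Fin (m + 1)),
        rowDet P.q T (k ∘ Equiv.swap a.castSucc a.succ) = 0 → rowDet P.q T k = 0 := by
      intro a k h
      by_cases e : k a.castSucc = k a.succ
      · exact rowDet_eq_zero hT a k e
      · rw [rowDet_swap hT a k e] at h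
        simpa [P.q_ne] using h
    have h2 : ∀ σ : Equiv.Perm (Fin (m + 1)), ∀ k : Fin (m + 1) → Fin (m + 1),
        rowDet P.q T (k ∘ σ) = 0 → rowDet P.q T k = 0 := by
      intro σ
      have hσ : σ ∈ Submonoid.closure (Set.range fun i : Fin m => Equiv.swap i.castSucc i.succ) := by
        rw [Equiv.Perm.mclosure_swap_castSucc_succ]; trivial
      induction hσ using Submonoid.closure_induction_right with
      | one => exact fun k h => h
      | mul_right τ _ s hs ih =>
        obtain ⟨a, rfl⟩ := hs
        exact fun k h => ih k (h1 a _ h)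
    simp only [Function.Injective, not_forall] at hk
    obtain ⟨b, c, hbc, hne⟩ := hk
    cases m with
    | zero => exact absurd (Fin.ext (by omega)) hne
    | succ m =>
      obtain ⟨σ, hσ⟩ : ∃ σ : Equiv.Perm (Fin (m + 1 + 1)), σ 0 = b ∧ σ 1 = c := by
        refine ⟨Equiv.swap 0 b * Equiv.swap 1 (Equiv.swap 0 b c), ?_, ?_⟩
        · have h0 : (0 : Fin (m + 1 + 1)) ≠ Equiv.swap 0 b c := by
            intro h
            have := congrArg (Equiv.swap 0 b) h
            simp at this
            exact hne this
          rw [Equiv.Perm.mul_apply, Equiv.swap_apply_of_ne_of_ne Fin.zero_ne_one h0,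
            Equiv.swap_apply_left]
        · simp
      refine h2 σ k (rowDet_eq_zero hT 0 _ ?_)
      simpa [hσ.1, hσ.2] using hbc

theorem prod_ofFn_sum {m : ℕ} {ι : Type*} [Fintype ι] (f : Fin m → ι → A) :
    (List.ofFn fun i => ∑ j, f i j).prod = ∑ k : Fin m → ι, (List.ofFn fun i => f i (k i)).prod := by
  induction m with
  | zero => simp
  | succ m ih =>
    rw [List.ofFn_succ, List.prod_cons, ih, Finset.sum_mul_sum]
    rw [← (Fin.consEquiv fun _ => ι).sum_comp, Fintype.sum_prod_type]
    simp [List.ofFn_succ, Fin.consEquiv]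

theorem prod_ofFn_mul {m : ℕ} (f g : Fin m → A) (h : ∀ i j, Commute (f i) (g j)) :
    (List.ofFn fun i => f i * g i).prod = (List.ofFn f).prod * (List.ofFn g).prod := by
  induction m with
  | zero => simp
  | succ m ih =>
    simp only [List.ofFn_succ, List.prod_cons]
    rw [ih (fun i => f i.succ) (fun i => g i.succ) (fun i j => h _ _)]
    have : Commute (g 0) (List.ofFn fun i => f (Fin.succ i)).prod := by
      refine Commute.list_prod_right _ _ ?_
      intro x hx
      obtain ⟨i, rfl⟩ := List.mem_ofFn' _ _ |>.1 hx
      exact (h _ _).symm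
    rw [mul_assoc, ← mul_assoc (g 0), this.eq]
    simp only [mul_assoc]

/-- Multiplicativity of the quantum determinant. -/
theorem rdet_mul {P : Param n} {S T : Matrix (Fin n) (Fin n) A} (hT : P.RTT T)
    (hc : ∀ i j k l, Commute (S i j) (T k l)) : rdet P.q (S * T) = rdet P.q S * rdet P.q T := by
  have e : ∀ k : Fin n → Fin n, (∑ σ : Equiv.Perm (Fin n), invWeight P.q σ •
      (List.ofFn fun i => S i (k i) * T (k i) (σ i)).prod) =
      (List.ofFn fun i => S i (k i)).prod * rowDet P.q T k := by
    intro k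
    rw [rowDet, Finset.mul_sum]
    refine Finset.sum_congr rfl fun σ _ => ?_
    rw [prod_ofFn_mul _ _ (fun i j => hc _ _ _ _), mul_smul_comm]
  have e2 : rdet P.q (S * T) = ∑ k : Fin n → Fin n,
      (List.ofFn fun i => S i (k i)).prod * rowDet P.q T k := by
    simp_rw [← e]
    rw [Finset.sum_comm, rdet]
    refine Finset.sum_congr rfl fun σ _ => ?_
    rw [← Finset.smul_sum, ← prod_ofFn_sum (fun i j => S i j * T j (σ i))]
    rfl
  rw [e2, ← Finset.sum_subset (Finset.subset_univ (Finset.univ.map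
    ⟨fun σ : Equiv.Perm (Fin n) => ⇑σ, DFunLike.coe_injective⟩))]
  · rw [Finset.sum_map, rdet, Finset.sum_mul]
    refine Finset.sum_congr rfl fun σ _ => ?_
    simp [rowDet_perm hT]
  · intro k _ hk
    rw [rowDet_not_injective hT, mul_zero]
    intro hinj
    apply hk
    simp only [Finset.mem_map, Finset.mem_univ, true_and]
    exact ⟨Equiv.ofBijective k (Finite.injective_iff_bijective.1 hinj), rfl⟩

end RowDet

section QGL

variable {n : ℕ}

/-- Free generators: `some (i, j)` stands for `t_ij` and `none` for `det_q⁻¹`. -/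
def freeT (n : ℕ) : Matrix (Fin n) (Fin n) (FreeAlgebra ℂ (Option (Fin n × Fin n))) :=
  fun i j => FreeAlgebra.ι ℂ (some (i, j))

/-- Defining relations of `GL_{p,u}(n)`: `R T₁ T₂ = T₂ T₁ R` and `det_q(T)` is invertible. -/
inductive QGLRel (P : Param n) : FreeAlgebra ℂ (Option (Fin n × Fin n)) →
    FreeAlgebra ℂ (Option (Fin n × Fin n)) → Prop
  | rtt (x y : Fin n × Fin n) : QGLRel P
      ((P.R.map (algebraMap ℂ (FreeAlgebra ℂ (Option (Fin n × Fin n)))) *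
        leg1 (freeT n) * leg2 (freeT n) : Mat2 n _) x y)
      ((leg2 (freeT n) * leg1 (freeT n) *
        P.R.map (algebraMap ℂ (FreeAlgebra ℂ (Option (Fin n × Fin n)))) : Mat2 n _) x y)
  | det_mul_inv : QGLRel P (rdet P.q (freeT n) * FreeAlgebra.ι ℂ none) 1
  | inv_mul_det : QGLRel P (FreeAlgebra.ι ℂ none * rdet P.q (freeT n)) 1

/-- `GL_{p,u}(n) = M_{p,u}(n)[det_q⁻¹]`, where `M_{p,u}(n)` is generated by the `t_ij` subject to
`R T₁ T₂ = T₂ T₁ R`. -/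
def QGL (P : Param n) : Type := RingQuot (QGLRel P)

noncomputable instance (P : Param n) : Ring (QGL P) := inferInstanceAs (Ring (RingQuot (QGLRel P)))

noncomputable instance (P : Param n) : Algebra ℂ (QGL P) :=
  inferInstanceAs (Algebra ℂ (RingQuot (QGLRel P)))

namespace QGL

/-- The quotient map. -/
noncomputable def mk (P : Param n) : FreeAlgebra ℂ (Option (Fin n × Fin n)) →ₐ[ℂ] QGL P :=
  RingQuot.mkAlgHom ℂ (QGLRel P)

/-- The matrix `T = (t_ij)`. -/
noncomputable def T (P : Param n) : Matrix (Fin n) (Fin n) (QGL P) :=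
  fun i j => mk P (FreeAlgebra.ι ℂ (some (i, j)))

/-- `det_q(T)`, as a row determinant. -/
noncomputable def detq (P : Param n) : QGL P := rdet P.q (T P)

/-- `det_p(T)`, as a column determinant. -/
noncomputable def detp (P : Param n) : QGL P := cdet P.p (T P)

/-- `det_q(T)⁻¹`. -/
noncomputable def detInv (P : Param n) : QGL P := mk P (FreeAlgebra.ι ℂ none)

theorem T_eq (P : Param n) : T P = (freeT n).map (mk P) := rfl

theorem detq_mul_detInv (P : Param n) : detq P * detInv P = 1 := by
  have := RingQuot.mkAlgHom_rel ℂ (QGLRel.det_mul_inv (P := P))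
  rw [map_mul, map_one] at this
  rw [detq, T_eq, ← rdet_map]; exact this

theorem detInv_mul_detq (P : Param n) : detInv P * detq P = 1 := by
  have := RingQuot.mkAlgHom_rel ℂ (QGLRel.inv_mul_det (P := P))
  rw [map_mul, map_one] at this
  rw [detq, T_eq, ← rdet_map]; exact this

theorem isUnit_detq (P : Param n) : IsUnit (detq P) :=
  ⟨⟨_, _, detq_mul_detInv P, detInv_mul_detq P⟩, rfl⟩

theorem RTT_T (P : Param n) : P.RTT (T P) := by
  rw [P.RTT_iff]
  intro a b c d
  have := RingQuot.mkAlgHom_rel ℂ (QGLRel.rtt (P := P) (a, b) (c, d))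
  rw [map_mul_leg, leg_mul_map] at this
  simp only [map_sum, map_smul, map_mul] at this
  exact this

variable {A : Type*} [Ring A] [Algebra ℂ A]

theorem hom_ext {P : Param n} {f g : QGL P →ₐ[ℂ] A} (h : ∀ i j, f (T P i j) = g (T P i j)) :
    f = g := by
  have hd : f (detq P) = g (detq P) := by
    rw [detq, rdet_map, rdet_map]
    congr 1; ext i j; exact h i j
  have hi : f (detInv P) = g (detInv P) := by
    have h1 : f (detInv P) * f (detq P) = 1 := by rw [← map_mul, detInv_mul_detq, map_one]
    have h2 : f (detq P) * g (detInv P) = 1 := by rw [hd, ← map_mul, detq_mul_detInv, map_one]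
    exact left_inv_eq_right_inv h1 h2
  refine RingQuot.ringQuot_ext' ℂ _ _ (FreeAlgebra.hom_ext (funext fun x => ?_))
  rcases x with _ | ⟨i, j⟩
  · exact hi
  · exact h i j

/-- Universal property of `GL_{p,u}(n)`. -/
noncomputable def lift (P : Param n) (S : Matrix (Fin n) (Fin n) A) (hS : P.RTT S)
    (hd : IsUnit (rdet P.q S)) : QGL P →ₐ[ℂ] A :=
  RingQuot.liftAlgHom ℂ ⟨FreeAlgebra.lift ℂ
    (fun x => x.elim (↑hd.unit⁻¹ : A) (fun ij => S ij.1 ij.2)), by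
      set F := FreeAlgebra.lift ℂ
        (fun x : Option (Fin n × Fin n) => x.elim (↑hd.unit⁻¹ : A) (fun ij => S ij.1 ij.2)) with hF
      have hT : ∀ i j, F (freeT n i j) = S i j := fun i j => by simp [hF, freeT]
      have hT' : (freeT n).map F = S := by ext i j; exact hT i j
      have hn : F (FreeAlgebra.ι ℂ none) = (↑hd.unit⁻¹ : A) := by simp [hF]
      intro x y h
      induction h with
      | rtt x y =>
        obtain ⟨a, b⟩ := x
        obtain ⟨c, d⟩ := y
        rw [map_mul_leg, leg_mul_map]
        simp only [map_sum, map_smul, map_mul, hT]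
        exact (P.RTT_iff S).1 hS a b c d
      | det_mul_inv => rw [map_mul, rdet_map, hT', hn, map_one]; exact hd.mul_val_inv
      | inv_mul_det => rw [map_mul, rdet_map, hT', hn, map_one]; exact hd.val_inv_mul⟩

theorem lift_T (P : Param n) (S : Matrix (Fin n) (Fin n) A) (hS : P.RTT S)
    (hd : IsUnit (rdet P.q S)) (i j : Fin n) : lift P S hS hd (T P i j) = S i j := by
  have := RingQuot.liftAlgHom_mkAlgHom_apply (S := ℂ) (s := QGLRel P) (FreeAlgebra.lift ℂ
    (fun x : Option (Fin n × Fin n) => x.elim (↑hd.unit⁻¹ : A) (fun ij => S ij.1 ij.2)))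
  refine (this _ _).trans ?_
  simp

end QGL

theorem exists_lt_perm {σ : Equiv.Perm (Fin n)} (h : σ ≠ 1) : (∃ i, i < σ i) ∧ ∃ i, σ i < i := by
  have hs : ∑ i, ((σ i : Fin n) : ℕ) = ∑ i : Fin n, (i : ℕ) := Equiv.sum_comp σ (fun i => (i : ℕ))
  constructor <;> by_contra! hc <;> apply h <;> ext i
  · exact (Finset.sum_eq_sum_iff_of_le (fun i _ => Fin.le_def.1 (hc i))).1 hs i (Finset.mem_univ i)
  · exact ((Finset.sum_eq_sum_iff_of_le (fun i _ => Fin.le_def.1 (hc i))).1 hs.symm i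
      (Finset.mem_univ i)).symm

theorem rdet_triangular {A : Type*} [Ring A] [Algebra ℂ A] (q : Fin n → Fin n → ℂ)
    (S : Matrix (Fin n) (Fin n) A)
    (h : (∀ i j, i < j → S i j = 0) ∨ ∀ i j, j < i → S i j = 0) :
    rdet q S = (List.ofFn fun i => S i i).prod := by
  rw [rdet, Finset.sum_eq_single 1]
  · rw [show ⇑(1 : Equiv.Perm (Fin n)) = fun i => i from rfl, invWeight_id, one_smul]
  · intro σ _ hσ
    obtain ⟨⟨i, hi⟩, ⟨j, hj⟩⟩ := exists_lt_perm hσ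
    have : (0 : A) ∈ List.ofFn fun i => S i (σ i) := by
      rcases h with h | h
      · exact (List.mem_ofFn' _ _).2 ⟨i, h _ _ hi⟩
      · exact (List.mem_ofFn' _ _).2 ⟨j, h _ _ hj⟩
    rw [List.prod_eq_zero this, smul_zero]
  · simp

theorem isUnit_rdet_triangular {A : Type*} [Ring A] [Algebra ℂ A] (q : Fin n → Fin n → ℂ)
    (S : Matrix (Fin n) (Fin n) A)
    (h : (∀ i j, i < j → S i j = 0) ∨ ∀ i j, j < i → S i j = 0) (hu : ∀ i, IsUnit (S i i)) :
    IsUnit (rdet q S) := by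
  rw [rdet_triangular q S h]
  refine Submonoid.list_prod_mem (IsUnit.submonoid A) ?_
  intro x hx
  obtain ⟨i, rfl⟩ := (List.mem_ofFn' _ _).1 hx
  exact hu i

namespace QGL

/-- The matrix `T ⊗̇ T` with entries `∑_k t_ik ⊗ t_kj`. -/
noncomputable def comulMat (P : Param n) : Matrix (Fin n) (Fin n) (QGL P ⊗[ℂ] QGL P) :=
  Matrix.of fun i j => ∑ k, T P i k ⊗ₜ[ℂ] T P k j

theorem comulMat_eq (P : Param n) : comulMat P =
    (T P).map (Algebra.TensorProduct.includeLeft (R := ℂ) (S := ℂ) (B := QGL P)) *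
      (T P).map (Algebra.TensorProduct.includeRight (R := ℂ) (A := QGL P)) := by
  ext i j
  simp [comulMat, Matrix.mul_apply]

theorem commute_legs (P : Param n) (x y : QGL P) :
    Commute (Algebra.TensorProduct.includeLeft (R := ℂ) (S := ℂ) (B := QGL P) x)
      (Algebra.TensorProduct.includeRight (R := ℂ) (A := QGL P) y) := by
  simp [Commute, SemiconjBy]

/-- Comultiplication `Δ(t_ij) = ∑_k t_ik ⊗ t_kj`. -/
noncomputable def comulHom (P : Param n) : QGL P →ₐ[ℂ] QGL P ⊗[ℂ] QGL P :=
  lift P (comulMat P)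
    (by
      rw [comulMat_eq]
      exact ((RTT_T P).map _).mul ((RTT_T P).map _) (fun i j k l => commute_legs P _ _))
    (by
      rw [comulMat_eq, rdet_mul ((RTT_T P).map _) (fun i j k l => commute_legs P _ _),
        ← rdet_map, ← rdet_map]
      exact ((isUnit_detq P).map _).mul ((isUnit_detq P).map _))

theorem comulHom_T (P : Param n) (i j : Fin n) :
    comulHom P (T P i j) = ∑ k, T P i k ⊗ₜ[ℂ] T P k j := lift_T _ _ _ _ _ _

/-- Counit `ε(t_ij) = δ_ij`. -/
noncomputable def counitHom (P : Param n) : QGL P →ₐ[ℂ] ℂ :=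
  lift P (1 : Matrix (Fin n) (Fin n) ℂ)
    (by
      have e1 : leg1 (1 : Matrix (Fin n) (Fin n) ℂ) = 1 := Matrix.one_kronecker_one
      have e2 : leg2 (1 : Matrix (Fin n) (Fin n) ℂ) = 1 := Matrix.one_kronecker_one
      simp [Param.RTT, e1, e2])
    (isUnit_rdet_triangular _ _ (Or.inl fun i j h => by simp [h.ne]) (fun i => by simp))

theorem counitHom_T (P : Param n) (i j : Fin n) :
    counitHom P (T P i j) = (1 : Matrix (Fin n) (Fin n) ℂ) i j := lift_T _ _ _ _ _ _

noncomputable instance (P : Param n) : Bialgebra ℂ (QGL P) :=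
  Bialgebra.ofAlgHom (comulHom P) (counitHom P)
    (hom_ext fun i j => by
      simp [comulHom_T, TensorProduct.sum_tmul, TensorProduct.tmul_sum]
      rw [Finset.sum_comm])
    (hom_ext fun i j => by
      simp [comulHom_T, counitHom_T, Matrix.one_apply, TensorProduct.ite_tmul])
    (hom_ext fun i j => by
      simp [comulHom_T, counitHom_T, Matrix.one_apply, TensorProduct.tmul_ite])

end QGL

end QGL

section Dual

variable {n : ℕ}

/-- Generators `l⁺_ij` (`i ≤ j`) and `l⁻_ij` (`j ≤ i`) of `U(R)`. -/
abbrev LGen (n : ℕ) : Type :=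
  {ij : Fin n × Fin n // ij.1 ≤ ij.2} ⊕ {ij : Fin n × Fin n // ij.2 ≤ ij.1}

/-- The upper triangular matrix `L⁺` of generators. -/
noncomputable def freeLp (n : ℕ) : Matrix (Fin n) (Fin n) (FreeAlgebra ℂ (LGen n)) :=
  Matrix.of fun i j => if h : i ≤ j then FreeAlgebra.ι ℂ (Sum.inl ⟨(i, j), h⟩) else 0

/-- The lower triangular matrix `L⁻` of generators. -/
noncomputable def freeLm (n : ℕ) : Matrix (Fin n) (Fin n) (FreeAlgebra ℂ (LGen n)) :=
  Matrix.of fun i j => if h : j ≤ i then FreeAlgebra.ι ℂ (Sum.inr ⟨(i, j), h⟩) else 0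

/-- The relations `R⁺ L₁ L₂' = L₂' L₁ R⁺` for `(L, L') = (L⁺, L⁺), (L⁻, L⁻), (L⁺, L⁻)`. -/
inductive URel (P : Param n) : FreeAlgebra ℂ (LGen n) → FreeAlgebra ℂ (LGen n) → Prop
  | pp (x y : Fin n × Fin n) : URel P
      ((P.Rplus.map (algebraMap ℂ (FreeAlgebra ℂ (LGen n))) *
        leg1 (freeLp n) * leg2 (freeLp n) : Mat2 n _) x y)
      ((leg2 (freeLp n) * leg1 (freeLp n) *
        P.Rplus.map (algebraMap ℂ (FreeAlgebra ℂ (LGen n))) : Mat2 n _) x y)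
  | mm (x y : Fin n × Fin n) : URel P
      ((P.Rplus.map (algebraMap ℂ (FreeAlgebra ℂ (LGen n))) *
        leg1 (freeLm n) * leg2 (freeLm n) : Mat2 n _) x y)
      ((leg2 (freeLm n) * leg1 (freeLm n) *
        P.Rplus.map (algebraMap ℂ (FreeAlgebra ℂ (LGen n))) : Mat2 n _) x y)
  | pm (x y : Fin n × Fin n) : URel P
      ((P.Rplus.map (algebraMap ℂ (FreeAlgebra ℂ (LGen n))) *
        leg1 (freeLp n) * leg2 (freeLm n) : Mat2 n _) x y)
      ((leg2 (freeLm n) * leg1 (freeLp n) *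
        P.Rplus.map (algebraMap ℂ (FreeAlgebra ℂ (LGen n))) : Mat2 n _) x y)

/-- The algebra `U(R) = U_{p,u}(gl_n)`. -/
def UR (P : Param n) : Type := RingQuot (URel P)

noncomputable instance (P : Param n) : Ring (UR P) := inferInstanceAs (Ring (RingQuot (URel P)))

noncomputable instance (P : Param n) : Algebra ℂ (UR P) :=
  inferInstanceAs (Algebra ℂ (RingQuot (URel P)))

/-- The quotient map. -/
noncomputable def UR.mk (P : Param n) : FreeAlgebra ℂ (LGen n) →ₐ[ℂ] UR P :=
  RingQuot.mkAlgHom ℂ (URel P)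

/-- The matrix `L⁺` over `U(R)`. -/
noncomputable def Lplus (P : Param n) : Matrix (Fin n) (Fin n) (UR P) := (freeLp n).map (UR.mk P)

/-- The matrix `L⁻` over `U(R)`. -/
noncomputable def Lminus (P : Param n) : Matrix (Fin n) (Fin n) (UR P) := (freeLm n).map (UR.mk P)

/-! ### The pairing of `U(R)` with `GL_{p,u}(n)` -/

/-- For `X ∈ End(ℂⁿ ⊗ ℂⁿ)`, the matrix over `End(ℂⁿ)` whose `(i, j)` entry has `(k, l)` entry
equal to the coefficient of `e_kl ⊗ e_ij` in `X`. -/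
def coeffMat (X : Mat2 n ℂ) : Matrix (Fin n) (Fin n) (Matrix (Fin n) (Fin n) ℂ) :=
  Matrix.of fun i j => Matrix.of fun k l => X (k, i) (l, j)

theorem RTT_coeffMat (P : Param n) (X : Mat2 n ℂ) (h : YB P.R (X.submatrix Prod.swap Prod.swap)
    (X.submatrix Prod.swap Prod.swap)) : P.RTT (coeffMat X) := by
  rw [P.RTT_iff]
  intro a b c d
  ext k l
  have := h a b k c d l
  simp only [Matrix.submatrix_apply, Prod.swap] at this
  simp only [Matrix.sum_apply, Matrix.smul_apply, Matrix.mul_apply, coeffMat, Matrix.of_apply,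
    smul_eq_mul, Finset.mul_sum]
  simp only [mul_assoc] at this
  rw [this]
  refine Finset.sum_congr rfl fun x _ => Finset.sum_congr rfl fun y _ => ?_
  refine Finset.sum_congr rfl fun z _ => ?_
  ring

theorem isUnit_coeffMat_xm (q : Fin n → Fin n → ℂ) (D h : Fin n → Fin n → ℂ)
    (hD : ∀ a b, D a b ≠ 0) (h0 : ∀ a, h a a = 0)
    (ht : (∀ a b, a < b → h b a = 0) ∨ ∀ a b, b < a → h b a = 0) :
    IsUnit (rdet q (coeffMat (xm D h))) := by
  refine isUnit_rdet_triangular q _ ?_ ?_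
  · have key : ∀ i j, i ≠ j → h j i = 0 → coeffMat (xm D h) i j = 0 := by
      intro i j hij h'
      ext k l
      simp only [coeffMat, xm, Matrix.of_apply, dl, Matrix.zero_apply]
      split_ifs <;> simp_all
    rcases ht with ht | ht
    · exact Or.inl fun i j hij => key i j hij.ne (ht i j hij)
    · exact Or.inr fun i j hij => key i j hij.ne' (ht i j hij)
  · intro i
    have : coeffMat (xm D h) i i = Matrix.diagonal fun k => D k i := by
      ext k l
      simp only [coeffMat, xm, Matrix.of_apply, dl, Matrix.diagonal_apply]
      split_ifs <;> simp_all
    rw [this, Matrix.isUnit_diagonal, Pi.isUnit_iff]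
    exact fun k => (hD k i).isUnit

theorem Param.Dp_ne (P : Param n) (a b : Fin n) : P.Dp a b ≠ 0 := by
  simp only [Param.Dp]
  split_ifs <;> simp [P.u_ne_zero, P.p_ne, P.q_ne]

theorem Param.Dm_ne (P : Param n) (a b : Fin n) : P.Dm a b ≠ 0 := by
  simp only [Param.Dm]
  split_ifs <;> simp [P.u_ne_zero, P.p_ne, P.q_ne]

/-- The algebra map `φ ↦ ((l⁺_kl, φ))_kl`, determined by `(L⁺₁, T₂) = R⁺`; it is multiplicative
because `Δ(L⁺) = L⁺ ⊗̇ L⁺`. -/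
noncomputable def pairPlus (P : Param n) : QGL P →ₐ[ℂ] Matrix (Fin n) (Fin n) ℂ :=
  QGL.lift P (coeffMat P.Rplus)
    (RTT_coeffMat P _ (by
      have := P.yang_baxter.1
      simpa [Param.Rplus] using this))
    (by
      rw [P.Rplus_eq]
      exact isUnit_coeffMat_xm _ _ _ (fun a b => P.Dp_ne b a) P.hp_self
        (Or.inl fun a b h => P.hp_lt h))

/-- The algebra map `φ ↦ ((l⁻_kl, φ))_kl`, determined by `(L⁻₁, T₂) = R⁻`. -/
noncomputable def pairMinus (P : Param n) : QGL P →ₐ[ℂ] Matrix (Fin n) (Fin n) ℂ :=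
  QGL.lift P (coeffMat P.Rminus)
    (RTT_coeffMat P _ P.yang_baxter.2.1)
    (by
      rw [P.Rminus_eq]
      exact isUnit_coeffMat_xm _ _ _ P.Dm_ne P.hm_self (Or.inr fun a b h => P.hm_lt h))

theorem pairPlus_T (P : Param n) (i j k l : Fin n) :
    pairPlus P (QGL.T P i j) k l = P.Rplus (k, i) (l, j) := by
  rw [pairPlus, QGL.lift_T]; rfl

theorem pairMinus_T (P : Param n) (i j k l : Fin n) :
    pairMinus P (QGL.T P i j) k l = P.Rminus (k, i) (l, j) := by
  rw [pairMinus, QGL.lift_T]; rfl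

/-- Linear functionals on `GL_{p,u}(n)`, with the convolution product. -/
abbrev QGL.Dual (P : Param n) : Type := WithConv (QGL P →ₗ[ℂ] ℂ)

/-- The matrix of functionals given by the entries of an algebra map to matrices. -/
noncomputable def entryFun {P : Param n} (f : QGL P →ₐ[ℂ] Matrix (Fin n) (Fin n) ℂ) :
    Matrix (Fin n) (Fin n) (QGL.Dual P) :=
  Matrix.of fun k l => WithConv.toConv (Matrix.entryLinearMap ℂ ℂ k l ∘ₗ f.toLinearMap)


/-- `leg1` as an algebra map. -/
def leg1Hom (n : ℕ) : Matrix (Fin n) (Fin n) ℂ →ₐ[ℂ] Mat2 n ℂ :=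
  AlgHom.ofLinearMap
    { toFun := leg1
      map_add' := fun x y => Matrix.add_kronecker x y 1
      map_smul' := fun c x => Matrix.smul_kronecker c x 1 }
    Matrix.one_kronecker_one
    (fun x y => by
      show leg1 _ = leg1 x * leg1 y
      simp [leg1, ← Matrix.mul_kronecker_mul])

/-- `leg2` as an algebra map. -/
def leg2Hom (n : ℕ) : Matrix (Fin n) (Fin n) ℂ →ₐ[ℂ] Mat2 n ℂ :=
  AlgHom.ofLinearMap
    { toFun := leg2
      map_add' := fun x y => Matrix.kronecker_add 1 x y
      map_smul' := fun c x => Matrix.kronecker_smul c 1 x }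
    Matrix.one_kronecker_one
    (fun x y => by
      show leg2 _ = leg2 x * leg2 y
      simp [leg2, ← Matrix.mul_kronecker_mul])

theorem commute_legHom (x y : Matrix (Fin n) (Fin n) ℂ) : Commute (leg1Hom n x) (leg2Hom n y) := by
  show leg1 x * leg2 y = leg2 y * leg1 x
  ext ⟨a, b⟩ ⟨c, d⟩
  rw [leg1_mul_leg2, leg2_mul_leg1, mul_comm]

/-- Convolution of algebra maps with values in the two tensor factors. -/
noncomputable def conv12 {P : Param n} (f g : QGL P →ₐ[ℂ] Matrix (Fin n) (Fin n) ℂ) :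
    QGL P →ₐ[ℂ] Mat2 n ℂ :=
  (Algebra.TensorProduct.lift ((leg1Hom n).comp f) ((leg2Hom n).comp g)
    (fun _ _ => commute_legHom _ _)).comp (QGL.comulHom P)

/-- Convolution of algebra maps with values in the two tensor factors, in the other order. -/
noncomputable def conv21 {P : Param n} (g f : QGL P →ₐ[ℂ] Matrix (Fin n) (Fin n) ℂ) :
    QGL P →ₐ[ℂ] Mat2 n ℂ :=
  (Algebra.TensorProduct.lift ((leg2Hom n).comp g) ((leg1Hom n).comp f)
    (fun _ _ => (commute_legHom _ _).symm)).comp (QGL.comulHom P)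

theorem conv12_apply {P : Param n} (f g : QGL P →ₐ[ℂ] Matrix (Fin n) (Fin n) ℂ) (φ : QGL P)
    (a b c d : Fin n) :
    conv12 f g φ (a, b) (c, d) = (entryFun f a c * entryFun g b d) φ := by
  rw [LinearMap.convMul_apply]
  show (Algebra.TensorProduct.lift ((leg1Hom n).comp f) ((leg2Hom n).comp g)
      (fun _ _ => commute_legHom _ _) (QGL.comulHom P φ) : Mat2 n ℂ) (a, b) (c, d) =
    LinearMap.mul' ℂ ℂ (TensorProduct.map _ _ (QGL.comulHom P φ))
  induction QGL.comulHom P φ using TensorProduct.induction_on with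
  | zero => simp
  | add x y hx hy => simp only [map_add, Matrix.add_apply, hx, hy]
  | tmul x y =>
    exact leg1_mul_leg2 (f x) (g y) a b c d

theorem conv21_apply {P : Param n} (g f : QGL P →ₐ[ℂ] Matrix (Fin n) (Fin n) ℂ) (φ : QGL P)
    (a b c d : Fin n) :
    conv21 g f φ (a, b) (c, d) = (entryFun g b d * entryFun f a c) φ := by
  rw [LinearMap.convMul_apply]
  show (Algebra.TensorProduct.lift ((leg2Hom n).comp g) ((leg1Hom n).comp f)
      (fun _ _ => (commute_legHom _ _).symm) (QGL.comulHom P φ) : Mat2 n ℂ) (a, b) (c, d) =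
    LinearMap.mul' ℂ ℂ (TensorProduct.map _ _ (QGL.comulHom P φ))
  induction QGL.comulHom P φ using TensorProduct.induction_on with
  | zero => simp
  | add x y hx hy => simp only [map_add, Matrix.add_apply, hx, hy]
  | tmul x y =>
    exact leg2_mul_leg1 (g x) (f y) a b c d

/-- An intertwining relation of algebra maps may be checked on the `t_ij`. -/
theorem QGL.intertwine {A : Type*} [Ring A] [Algebra ℂ A] {P : Param n} {f g : QGL P →ₐ[ℂ] A}
    {r : A} (hr : IsUnit r) (h : ∀ i j, r * f (QGL.T P i j) = g (QGL.T P i j) * r) (φ : QGL P) :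
    r * f φ = g φ * r := by
  obtain ⟨r, rfl⟩ := hr
  let g' : QGL P →ₐ[ℂ] A := AlgHom.ofLinearMap
    (LinearMap.mulRight ℂ (r : A) ∘ₗ LinearMap.mulLeft ℂ (↑r⁻¹ : A) ∘ₗ g.toLinearMap)
    (by simp) (fun x y => by simp [mul_assoc])
  have hg : ∀ φ, g' φ = ↑r⁻¹ * g φ * ↑r := fun φ => by simp [g']
  have : f = g' := QGL.hom_ext fun i j => by
    rw [hg, mul_assoc, ← h, ← mul_assoc, Units.inv_mul, one_mul]
  rw [this, hg, mul_assoc, Units.mul_inv_cancel_left]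

theorem entryFun_rel {P : Param n} (f g : QGL P →ₐ[ℂ] Matrix (Fin n) (Fin n) ℂ) (X Y : Mat2 n ℂ)
    (hf : ∀ i j k l, f (QGL.T P i j) k l = X (k, i) (l, j))
    (hg : ∀ i j k l, g (QGL.T P i j) k l = Y (k, i) (l, j)) (h : YB P.Rplus X Y)
    (a b c d : Fin n) :
    ∑ x, ∑ y, P.Rplus (a, b) (x, y) • (entryFun f x c * entryFun g y d) =
      ∑ x, ∑ y, P.Rplus (x, y) (c, d) • (entryFun g b y * entryFun f a x) := by
  have key : ∀ φ, P.Rplus * conv12 f g φ = conv21 g f φ * P.Rplus := by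
    refine QGL.intertwine P.isUnit_Rplus fun i j => ?_
    ext ⟨a, b⟩ ⟨c, d⟩
    have e1 : ∀ a b c d, conv12 f g (QGL.T P i j) (a, b) (c, d) =
        ∑ k, X (a, i) (c, k) * Y (b, k) (d, j) := by
      intro a b c d
      simp only [conv12, AlgHom.comp_apply, QGL.comulHom_T, map_sum, Matrix.sum_apply]
      refine Finset.sum_congr rfl fun k _ => ?_
      rw [← hf, ← hg]
      exact leg1_mul_leg2 _ _ a b c d
    have e2 : ∀ a b c d, conv21 g f (QGL.T P i j) (a, b) (c, d) =
        ∑ k, Y (b, i) (d, k) * X (a, k) (c, j) := by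
      intro a b c d
      simp only [conv21, AlgHom.comp_apply, QGL.comulHom_T, map_sum, Matrix.sum_apply]
      refine Finset.sum_congr rfl fun k _ => ?_
      rw [← hf, ← hg]
      exact leg2_mul_leg1 _ _ a b c d
    rw [Matrix.mul_apply, Matrix.mul_apply, Fintype.sum_prod_type, Fintype.sum_prod_type]
    simp only [e1, e2, Finset.mul_sum, Finset.sum_mul]
    simpa only [mul_assoc] using h a b i c d j
  ext φ
  have := congrArg (fun M : Mat2 n ℂ => M (a, b) (c, d)) (key φ)
  simp only [Matrix.mul_apply, Fintype.sum_prod_type, conv12_apply, conv21_apply] at this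
  simp only [WithConv.ofConv_sum, WithConv.ofConv_smul, LinearMap.sum_apply, LinearMap.smul_apply,
    smul_eq_mul]
  rw [this]
  simp only [mul_comm]

/-- The image of an algebra map to matrices is triangular if the images of the `t_ij` are. -/
theorem QGL.triangular {α : Type*} [LinearOrder α] (b : Fin n → α) {P : Param n}
    (f : QGL P →ₐ[ℂ] Matrix (Fin n) (Fin n) ℂ)
    (h : ∀ i j, Matrix.BlockTriangular (f (QGL.T P i j)) b) (φ : QGL P) :
    Matrix.BlockTriangular (f φ) b := by
  let S : Subalgebra ℂ (QGL P) := (Matrix.blockTriangularSubalgebra ℂ ℂ b).comap f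
  have hS : ∀ φ, φ ∈ S ↔ Matrix.BlockTriangular (f φ) b := fun φ => Iff.rfl
  have hd : QGL.detq P ∈ S := by
    refine S.sum_mem fun σ _ => S.smul_mem (S.list_prod_mem ?_) _
    intro x hx
    obtain ⟨i, rfl⟩ := (List.mem_ofFn' _ _).1 hx
    exact h _ _
  have hi : QGL.detInv P ∈ S := by
    rw [hS] at hd ⊢
    have h1 : f (QGL.detq P) * f (QGL.detInv P) = 1 := by
      rw [← map_mul, QGL.detq_mul_detInv, map_one]
    have h2 : f (QGL.detInv P) * f (QGL.detq P) = 1 := by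
      rw [← map_mul, QGL.detInv_mul_detq, map_one]
    let _ : Invertible (f (QGL.detq P)) := ⟨_, h2, h1⟩
    rw [← Matrix.inv_eq_right_inv h1]
    exact Matrix.blockTriangular_inv_of_blockTriangular hd
  rw [← hS]
  obtain ⟨y, rfl⟩ := RingQuot.mkAlgHom_surjective ℂ (QGLRel P) φ
  show QGL.mk P y ∈ S
  induction y with
  | grade0 r => rw [AlgHom.commutes]; exact S.algebraMap_mem r
  | grade1 x =>
    rcases x with _ | ⟨i, j⟩
    · exact hi
    · exact h i j
  | mul a b ha hb => rw [map_mul]; exact S.mul_mem ha hb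
  | add a b ha hb => rw [map_add]; exact S.add_mem ha hb

theorem entryFun_pairPlus (P : Param n) (k l : Fin n) (h : ¬ k ≤ l) :
    entryFun (pairPlus P) k l = 0 := by
  ext φ
  refine QGL.triangular (fun i => i) (pairPlus P) (fun i j k l hkl => ?_) φ (not_le.1 h)
  rw [pairPlus_T, P.Rplus_eq]
  have : k ≠ l := ne_of_gt hkl
  simp only [xm, dl]
  split_ifs <;> simp_all [P.hp_lt]

theorem entryFun_pairMinus (P : Param n) (k l : Fin n) (h : ¬ l ≤ k) :
    entryFun (pairMinus P) k l = 0 := by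
  ext φ
  refine QGL.triangular (fun i => OrderDual.toDual i) (pairMinus P) (fun i j k l hkl => ?_) φ
    (OrderDual.toDual_lt_toDual.2 (not_le.1 h))
  have hkl' : k < l := OrderDual.toDual_lt_toDual.1 hkl
  rw [pairMinus_T, P.Rminus_eq]
  have : k ≠ l := ne_of_lt hkl'
  simp only [xm, dl]
  split_ifs <;> simp_all [P.hm_lt]

/-- The pairing on the free algebra. -/
noncomputable def pairingFree (P : Param n) : FreeAlgebra ℂ (LGen n) →ₐ[ℂ] QGL.Dual P :=
  FreeAlgebra.lift ℂ (Sum.elim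
    (fun ij => entryFun (pairPlus P) ij.1.1 ij.1.2)
    (fun ij => entryFun (pairMinus P) ij.1.1 ij.1.2))

theorem pairingFree_Lp (P : Param n) (i j : Fin n) :
    pairingFree P (freeLp n i j) = entryFun (pairPlus P) i j := by
  by_cases h : i ≤ j
  · simp [pairingFree, freeLp, h]
  · simp [freeLp, h, entryFun_pairPlus P i j h]

theorem pairingFree_Lm (P : Param n) (i j : Fin n) :
    pairingFree P (freeLm n i j) = entryFun (pairMinus P) i j := by
  by_cases h : j ≤ i
  · simp [pairingFree, freeLm, h]
  · simp [freeLm, h, entryFun_pairMinus P i j h]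

/-- The pairing of `U(R)` with `GL_{p,u}(n)` determined by `(L^±₁, T₂) = R^±`, as the map sending
`a ∈ U(R)` to the functional `(a, ·)`; thus `(ab, φ) = (a ⊗ b, Δ(φ))`. -/
noncomputable def pairing (P : Param n) : UR P →ₐ[ℂ] QGL.Dual P :=
  RingQuot.liftAlgHom ℂ ⟨pairingFree P, by
      intro x y h
      induction h with
      | pp x y =>
        obtain ⟨a, b⟩ := x
        obtain ⟨c, d⟩ := y
        rw [map_mul_leg, leg_mul_map]
        simp only [map_sum, map_smul, map_mul, pairingFree_Lp]
        exact entryFun_rel _ _ _ _ (pairPlus_T P) (pairPlus_T P) P.yang_baxter.2.2.1 a b c d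
      | mm x y =>
        obtain ⟨a, b⟩ := x
        obtain ⟨c, d⟩ := y
        rw [map_mul_leg, leg_mul_map]
        simp only [map_sum, map_smul, map_mul, pairingFree_Lm]
        exact entryFun_rel _ _ _ _ (pairMinus_T P) (pairMinus_T P) P.yang_baxter.2.2.2.1 a b c d
      | pm x y =>
        obtain ⟨a, b⟩ := x
        obtain ⟨c, d⟩ := y
        rw [map_mul_leg, leg_mul_map]
        simp only [map_sum, map_smul, map_mul, pairingFree_Lp, pairingFree_Lm]
        exact entryFun_rel _ _ _ _ (pairPlus_T P) (pairMinus_T P) P.yang_baxter.2.2.2.2 a b c d⟩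

theorem pairing_Lplus (P : Param n) (k l : Fin n) :
    pairing P (Lplus P k l) = entryFun (pairPlus P) k l :=
  (RingQuot.liftAlgHom_mkAlgHom_apply _ _ _ _).trans (pairingFree_Lp P k l)

theorem pairing_Lminus (P : Param n) (k l : Fin n) :
    pairing P (Lminus P k l) = entryFun (pairMinus P) k l :=
  (RingQuot.liftAlgHom_mkAlgHom_apply _ _ _ _).trans (pairingFree_Lm P k l)

/-! ### The actions of `U(R)` and the operators in the identity -/

/-- The left action `a.φ = (id ⊗ a)Δ(φ)` of `a ∈ U(R)` on `GL_{p,u}(n)`. -/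
noncomputable def leftAct (P : Param n) (a : UR P) : Module.End ℂ (QGL P) :=
  (TensorProduct.rid ℂ (QGL P)).toLinearMap ∘ₗ
    LinearMap.lTensor (QGL P) (pairing P a).ofConv ∘ₗ Coalgebra.comul

/-- The right action `φ.a = (a ⊗ id)Δ(φ)` of `a ∈ U(R)` on `GL_{p,u}(n)`, as an operator `a°`. -/
noncomputable def rightAct (P : Param n) (a : UR P) : Module.End ℂ (QGL P) :=
  (TensorProduct.lid ℂ (QGL P)).toLinearMap ∘ₗ
    LinearMap.rTensor (QGL P) (pairing P a).ofConv ∘ₗ Coalgebra.comul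

/-- `L(λ) = λ L⁺ - λ⁻¹ L⁻`. -/
noncomputable def Lmat (P : Param n) (s : ℂ) : Matrix (Fin n) (Fin n) (UR P) :=
  s • Lplus P - s⁻¹ • Lminus P

/-- `[n]_v! = ∏_{m=1}^{n} (1 + v + ⋯ + v^{m-1})`. -/
noncomputable def qFactorial (v : ℂ) (n : ℕ) : ℂ :=
  ∏ m ∈ Finset.range n, ∑ i ∈ Finset.range (m + 1), v ^ i

/-- The element `c(x) = ∑_{σ,τ} (-p)_σ (-q)_τ L_{σ_n τ_n}(x u^{1-n}) ⋯ L_{σ_2 τ_2}(x u^{-1})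
L_{σ_1 τ_1}(x)` of `U(R)`; the factors come in decreasing order of the index. -/
noncomputable def cElem (P : Param n) (x : ℂ) : UR P :=
  ∑ σ : Equiv.Perm (Fin n), ∑ τ : Equiv.Perm (Fin n), (invWeight P.p σ * invWeight P.q τ) •
    (List.ofFn fun i : Fin n => Lmat P (x * (P.u ^ (i : ℕ))⁻¹) (σ i) (τ i)).reverse.prod

/-- `d(x) = (u - u⁻¹)^{-n} ([n]_{u²}!)^{-1} c(x)°`. -/
noncomputable def dOp (P : Param n) (x : ℂ) : Module.End ℂ (QGL P) :=
  (((P.u - P.u⁻¹) ^ n)⁻¹ * (qFactorial (P.u ^ 2) n)⁻¹) • rightAct P (cElem P x)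

/-- The increasing enumeration of `{1, …, n} \ {i}`. -/
def deleteIdx (i : Fin n) : Fin (n - 1) → Fin n :=
  (({i}ᶜ : Finset (Fin n)).orderEmbOfFin (by simp [Finset.card_compl]))

/-- The matrix `S(T)` of the antipode, `S(t_ij) = (-1)^{i-j} (∏_{l<i} q_li / ∏_{l<j} q_lj)
det_q(T with row j and column i removed) det_q(T)⁻¹`. -/
noncomputable def antipodeMat (P : Param n) : Matrix (Fin n) (Fin n) (QGL P) :=
  Matrix.of fun i j =>
    ((-1) ^ ((i : ℕ) + (j : ℕ)) * ((∏ l ∈ Finset.Iio i, P.q l i) / ∏ l ∈ Finset.Iio j, P.q l j)) •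
      (minor P.q (QGL.T P) (deleteIdx j) (deleteIdx i) * QGL.detInv P)

/-- The matrix of operators `L(λ)S(T)°`, i.e. `φ ↦ (L(λ).φ) S(T)`. -/
noncomputable def LS (P : Param n) (s : ℂ) : Matrix (Fin n) (Fin n) (Module.End ℂ (QGL P)) :=
  Matrix.of fun i j => ∑ k, LinearMap.mulRight ℂ (antipodeMat P k j) * leftAct P (Lmat P s i k)

/-- The matrix `∂(λ)` of quantum partial derivatives, `L(λ)S(T)° = (u - u⁻¹) ∂(λ)ᵗ`. -/
noncomputable def partialMat (P : Param n) (s : ℂ) :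
    Matrix (Fin n) (Fin n) (Module.End ℂ (QGL P)) :=
  (P.u - P.u⁻¹)⁻¹ • (LS P s).transpose

end Dual

end QuantumGL

/-! The matrices `L⁺` and `L⁻` are grouplike, so `φ ↦ (l_ij.φ)` and `φ ↦ (φ.l_ij)` are algebra maps
into matrices over `GL_{p,u}(n)`. They are intertwined by `T`, that is `T (L(s).φ) = (φ.L(s)) T`: on
the generators `t_ij` this is the relation `R T₁ T₂ = T₂ T₁ R`. Since `S(T)` is a right inverse of
`T`, which follows from Laplace expansion of the quantum determinant, one gets `L_ij(s)° = ∑_k t_ik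
LS_kj(s)` (`Lright_eq_sum`), the analogue of writing a polarization operator as a coordinate times a
derivative.

The Capelli element is then evaluated as follows. The right action reverses products, so `c(s)°` is
a double alternating sum of the products `L_{σ_1τ_1}(s)° ⋯ L_{σ_nτ_n}(s u^{1-n})°`. For fixed `τ`
the sum over `σ` is quantum antisymmetric in `τ`, because the spectral parameters of neighbours have
ratio `u` (`Lright_rel`); it equals `(-p)_τ` times its value at `τ = id`. What is left is `∑_τ
(-q)_τ (-p)_τ`, and since `p_ij q_ij = u²` for `i < j` this is the generating function of inversions
at `u²`, namely `[n]_{u²}!` (`rightAct_cElem`).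

In the remaining single sum at `s = x u^{n-1}` the last factor has parameter `x`. Write it as `∑_b
t_{·b} LS_{bn}(x)` and move `t_{·b}` to the far left. Under antisymmetrization each exchange costs a
sign and replaces `L(su)` by `L(s)` (`Lright_mul_T`), so afterwards the last remaining `L` has
parameter `x` again and the process repeats (`altSum_normal`). This shift is the Capelli correction.
All coordinates end up on the left, in an alternating sum of columns of `T` that vanishes for
repeated columns and is otherwise a multiple of `det_p(T)` (`rowDet_mulLeft_T`). The multiple is the
weight of a reversed permutation, equal to `∏_{i<j} (-p_ij)` times its `p⁻¹`-weight
(`invWeight_comp_rev`), and the signs cancel those of the exchanges.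

All reorderings rest on `altSum_adjacent`: an alternating sum depends on two neighbouring vectors
only through their `2 × 2` quantum minors. -/

namespace QuantumGL

/-! ### Alternating sums over permutations -/

section Alternating

variable {n : ℕ} {A : Type*} [Ring A] [Algebra ℂ A]

/-- The same parameters with `p` and `q` interchanged. -/
def Param.flip (P : Param n) : Param n where
  u := P.u
  p := P.q
  q := P.p
  u_ne_zero := P.u_ne_zero
  u_sq_ne := P.u_sq_ne
  p_mul_q i j h := by rw [mul_comm, P.p_mul_q i j h]
  p_mul_p := P.q_mul_q
  q_mul_q := P.p_mul_p
  p_self := P.q_self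
  q_self := P.p_self

/-- The alternating sum `∑_σ (-q)_σ F_1(σ_1) ⋯ F_n(σ_n)` of a sequence of vectors over `A`. -/
noncomputable def altSum (q : Fin n → Fin n → ℂ) (F : ℕ → Fin n → A) : A :=
  ∑ σ : Equiv.Perm (Fin n), invWeight q σ • (List.ofFn fun i : Fin n => F i (σ i)).prod

/-- Sequences are indexed by `ℕ` so that positions can be shifted freely; values from position `n`
on never enter, and default values there are harmless. -/
theorem altSum_congr {q : Fin n → Fin n → ℂ} {F G : ℕ → Fin n → A}
    (h : ∀ i < n, ∀ j, F i j = G i j) : altSum q F = altSum q G := by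
  refine Finset.sum_congr rfl fun σ _ => ?_
  congr 3
  funext i
  exact h i i.2 _

/-- Replacing two adjacent vectors `F_a, F_{a+1}` by vectors whose `q`-minors are proportional to
those of `F_a, F_{a+1}`. -/
theorem altSum_adjacent (P : Param n) {F G : ℕ → Fin n → A} (a : ℕ) (ha : a + 1 < n)
    (hFG : ∀ x, x ≠ a → x ≠ a + 1 → F x = G x) (c : ℂ)
    (h : ∀ i j, i ≠ j → F a i * F (a + 1) j - P.q i j • (F a j * F (a + 1) i) =
      c • (G a i * G (a + 1) j - P.q i j • (G a j * G (a + 1) i))) :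
    altSum P.q F = c • altSum P.q G := by
  obtain ⟨m, rfl⟩ : ∃ m, n = m + 1 := ⟨n - 1, by omega⟩
  obtain ⟨pre, post, h1, h2⟩ := prod_ofFn_split (A := A) (⟨a, by omega⟩ : Fin m)
  set b : Fin m := ⟨a, by omega⟩ with hb
  have key : ∀ H : ℕ → Fin (m + 1) → A, (∀ x, x ≠ a → x ≠ a + 1 → H x = F x) →
      (2 : ℂ) • altSum P.q H = ∑ σ : Equiv.Perm (Fin (m + 1)), invWeight P.q σ •
        (pre (fun i => F i (σ i)) *
        (H a (σ b.castSucc) * H (a + 1) (σ b.succ) -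
          P.q (σ b.castSucc) (σ b.succ) • (H a (σ b.succ) * H (a + 1) (σ b.castSucc)))
        * post (fun i => F i (σ i))) := by
    intro H hH
    have hH' : ∀ x : Fin (m + 1), x ≠ b.castSucc → x ≠ b.succ → H x = F x := by
      intro x hx hx'
      refine hH _ (fun e => hx (Fin.ext e)) (fun e => hx' (Fin.ext e))
    -- One copy is kept and the other is reindexed by `σ ↦ σ ∘ (a a+1)`, which multiplies the weight
    -- by `-q`. The two terms for the same `σ` combine into a quantum minor of the vectors in
    -- positions `a` and `a + 1`.
    rw [two_smul]
    nth_rewrite 2 [altSum]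
    rw [← Equiv.sum_comp (Equiv.mulRight (Equiv.swap b.castSucc b.succ)), altSum,
      ← Finset.sum_add_distrib]
    refine Finset.sum_congr rfl fun σ _ => ?_
    have hw := invWeight_swap P b σ (σ.injective.ne (Fin.castSucc_lt_succ (i := b)).ne)
    have hw' : invWeight P.q (Equiv.mulRight (Equiv.swap b.castSucc b.succ) σ) =
      invWeight P.q (σ ∘ Equiv.swap b.castSucc b.succ) := rfl
    rw [hw', hw, h1, h1]
    have e1 := h2 (fun i => H i (σ i)) (fun i => F i (σ i)) (by
      intro x hx hx'; simp only [hH' x hx hx'])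
    have e2 := h2 (fun i => H i (Equiv.mulRight (Equiv.swap b.castSucc b.succ) σ i))
      (fun i => F i (σ i)) (by
      intro x hx hx'; simp only [hH' x hx hx', Equiv.coe_mulRight, Equiv.Perm.mul_apply,
        Equiv.swap_apply_of_ne_of_ne hx hx'])
    have v1 : ((b.castSucc : Fin (m + 1)) : ℕ) = a := rfl
    have v2 : ((b.succ : Fin (m + 1)) : ℕ) = a + 1 := rfl
    rw [e1.1, e1.2, e2.1, e2.2]
    simp only [Equiv.coe_mulRight, Equiv.Perm.mul_apply, Equiv.swap_apply_left, v1, v2,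
      Equiv.swap_apply_right, mul_sub, sub_mul, smul_sub, mul_smul_comm, smul_mul_assoc, smul_smul]
    rw [neg_mul, neg_smul, mul_comm, ← sub_eq_add_neg]
  have : (2 : ℂ) • altSum P.q F = (2 : ℂ) • (c • altSum P.q G) := by
    rw [smul_comm, key F (fun _ _ _ => rfl), key G (fun x hx hx' => (hFG x hx hx').symm),
      Finset.smul_sum]
    refine Finset.sum_congr rfl fun σ _ => ?_
    rw [h _ _ (σ.injective.ne (Fin.castSucc_lt_succ (i := b)).ne), mul_smul_comm,
      smul_mul_assoc, smul_comm]
  exact smul_right_injective A (two_ne_zero (α := ℂ)) this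

end Alternating

/-! ### Permutations by their first value -/

section FirstValue

variable {n : ℕ}

theorem cons_succAbove_injective (i : Fin (n + 1)) (σ : Equiv.Perm (Fin n)) :
    Function.Injective (Fin.cons i (i.succAbove ∘ σ) : Fin (n + 1) → Fin (n + 1)) := by
  refine Fin.cons_injective_iff.2 ⟨?_, Fin.succAbove_right_injective.comp σ.injective⟩
  rintro ⟨x, hx⟩
  exact Fin.succAbove_ne _ _ hx

/-- The permutation with first value `i` and remaining values in the relative order of `σ`. -/
noncomputable def consPerm (i : Fin (n + 1)) (σ : Equiv.Perm (Fin n)) : Equiv.Perm (Fin (n + 1)) :=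
  Equiv.ofBijective _ (Finite.injective_iff_bijective.1 (cons_succAbove_injective i σ))

theorem coe_consPerm (i : Fin (n + 1)) (σ : Equiv.Perm (Fin n)) :
    ⇑(consPerm i σ) = Fin.cons i (i.succAbove ∘ σ) := rfl

theorem sum_perm_succ {M : Type*} [AddCommMonoid M] (f : Equiv.Perm (Fin (n + 1)) → M) :
    ∑ σ, f σ = ∑ i, ∑ σ, f (consPerm i σ) := by
  rw [← Fintype.sum_prod_type']
  symm
  refine Fintype.sum_bijective (fun x : Fin (n + 1) × Equiv.Perm (Fin n) => consPerm x.1 x.2)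
    ((Fintype.bijective_iff_injective_and_card _).2 ⟨?_, ?_⟩) _ _ (fun _ => rfl)
  · rintro ⟨i, σ⟩ ⟨j, τ⟩ h
    have h0 := DFunLike.congr_fun h 0
    simp only [coe_consPerm, Fin.cons_zero] at h0
    subst h0
    refine Prod.ext rfl (Equiv.ext fun x => ?_)
    have h1 := DFunLike.congr_fun h x.succ
    simpa only [coe_consPerm, Fin.cons_succ, Function.comp_apply,
      Fin.succAbove_right_inj] using h1
  · simp [Fintype.card_perm, Nat.factorial_succ]

theorem invWeight_eq_prod {m : ℕ} (q : Fin n → Fin n → ℂ) (k : Fin m → Fin n) :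
    invWeight q k = ∏ a, ∏ b, if a < b ∧ k b < k a then -q (k b) (k a) else 1 := by
  rw [invWeight, Finset.prod_filter, Fintype.prod_prod_type]

theorem invWeight_cons {m : ℕ} (q : Fin n → Fin n → ℂ) (i : Fin n) (k : Fin m → Fin n) :
    invWeight q (Fin.cons i k : Fin (m + 1) → Fin n) =
      (∏ b, if k b < i then -q (k b) i else 1) * invWeight q k := by
  rw [invWeight_eq_prod, invWeight_eq_prod, Fin.prod_univ_succ]
  congr 1
  · rw [Fin.prod_univ_succ]; simp
  · refine Finset.prod_congr rfl fun a _ => ?_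
    rw [Fin.prod_univ_succ]; simp

/-- The values `i.succAbove (σ b)` run once through all indices other than `i`, so `σ` drops out.
This computes the contribution of the inversions that involve a first value `i`. -/
theorem prod_succAbove_lt {M : Type*} [CommMonoid M] (i : Fin (n + 1)) (f : Fin (n + 1) → M)
    (σ : Equiv.Perm (Fin n)) :
    (∏ b, if i.succAbove (σ b) < i then f (i.succAbove (σ b)) else 1) = ∏ l ∈ Finset.Iio i, f l := by
  rw [Equiv.prod_comp σ (fun b => if i.succAbove b < i then f (i.succAbove b) else 1)]
  have h := Fin.prod_univ_succAbove (fun l => if l < i then f l else 1) i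
  rw [if_neg (lt_irrefl i), one_mul] at h
  rw [← h, ← Finset.prod_filter]
  congr 1
  ext l; simp

theorem invWeight_consPerm (q : Fin (n + 1) → Fin (n + 1) → ℂ) (i : Fin (n + 1))
    (σ : Equiv.Perm (Fin n)) : invWeight q (consPerm i σ) =
      (∏ l ∈ Finset.Iio i, -q l i) * invWeight q (i.succAbove ∘ σ) := by
  rw [coe_consPerm, invWeight_cons]
  congr 1
  exact prod_succAbove_lt i (fun l => -q l i) σ

theorem invWeight_const_succAbove (v : ℂ) (i : Fin (n + 1)) (σ : Equiv.Perm (Fin n)) :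
    invWeight (fun _ _ => v) (i.succAbove ∘ σ) = invWeight (fun _ _ => v) σ := by
  simp [invWeight_eq_prod, Fin.succAbove_lt_succAbove_iff]

/-- The generating function of the number of inversions. -/
theorem sum_invWeight_const (v : ℂ) (n : ℕ) :
    ∑ σ : Equiv.Perm (Fin n), invWeight (fun _ _ : Fin n => -v) σ = qFactorial v n := by
  induction n with
  | zero => simp [qFactorial, invWeight]
  | succ n ih =>
    -- A first value `i` creates exactly `i` inversions, so the sum over first values yields the new
    -- factor `1 + v + ⋯ + v^n`.
    rw [sum_perm_succ, qFactorial, Finset.prod_range_succ, ← qFactorial, ← ih,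
      ← Fin.sum_univ_eq_sum_range (fun i => v ^ i), Finset.mul_sum]
    refine Finset.sum_congr rfl fun i _ => ?_
    rw [Finset.sum_mul]
    refine Finset.sum_congr rfl fun σ _ => ?_
    rw [invWeight_consPerm, invWeight_const_succAbove, mul_comm]
    simp

theorem invWeight_mul (q q' : Fin n → Fin n → ℂ) {m : ℕ} (k : Fin m → Fin n) :
    invWeight q k * invWeight q' k = invWeight (fun i j => -(q i j * q' i j)) k := by
  simp [invWeight, ← Finset.prod_mul_distrib]

/-- Each inversion contributes `(-q)(-p) = u²` whatever its indices, so only the number of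
inversions matters. This is the source of the normalization by `[n]_{u²}!`. -/
theorem sum_invWeight_p_mul_q (P : Param n) :
    ∑ σ : Equiv.Perm (Fin n), invWeight P.q σ * invWeight P.p σ = qFactorial (P.u ^ 2) n := by
  rw [← sum_invWeight_const]
  refine Finset.sum_congr rfl fun σ _ => ?_
  rw [invWeight_mul]
  refine Finset.prod_congr rfl fun ab h => ?_
  simp only [Finset.mem_filter] at h
  rw [← P.p_mul_q _ _ h.2.2, mul_comm (P.p _ _)]

/-- A symmetric `g` is a function on two-element subsets, and `σ` permutes these; `min` and `max`
put the image of a pair back in increasing order. -/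
theorem prod_lt_comp_perm {M : Type*} [CommMonoid M] (g : Fin n → Fin n → M)
    (hg : ∀ i j, g i j = g j i) (σ : Equiv.Perm (Fin n)) :
    ∏ ab : Fin n × Fin n with ab.1 < ab.2, g (σ ab.1) (σ ab.2) =
      ∏ ab : Fin n × Fin n with ab.1 < ab.2, g ab.1 ab.2 := by
  refine Finset.prod_nbij' (fun ab => (min (σ ab.1) (σ ab.2), max (σ ab.1) (σ ab.2)))
    (fun ab => (min (σ.symm ab.1) (σ.symm ab.2), max (σ.symm ab.1) (σ.symm ab.2))) ?_ ?_ ?_ ?_ ?_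
  · rintro ⟨a, b⟩ h
    have : a ≠ b := ne_of_lt (by simpa using h)
    simpa using this.symm
  · rintro ⟨a, b⟩ h
    have : a ≠ b := ne_of_lt (by simpa using h)
    simpa using this.symm
  · rintro ⟨a, b⟩ h
    have h : a < b := by simpa using h
    rcases le_total (σ a) (σ b) with h' | h' <;> simp [h', h.le]
  · rintro ⟨a, b⟩ h
    have h : a < b := by simpa using h
    rcases le_total (σ.symm a) (σ.symm b) with h' | h' <;> simp [h', h.le]
  · rintro ⟨a, b⟩ _
    rcases le_total (σ a) (σ b) with h' | h' <;> simp [h', hg]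

/-- Reversing a permutation turns the inversions into the non-inversions. -/
theorem invWeight_comp_rev (P : Param n) (σ : Equiv.Perm (Fin n)) :
    invWeight P.p (σ ∘ Fin.rev) = (∏ i, ∏ j ∈ Finset.Ioi i, -P.p i j) *
      invWeight (fun i j => (P.p i j)⁻¹) σ := by
  have h1 : (∏ i, ∏ j ∈ Finset.Ioi i, -P.p i j) = ∏ ab : Fin n × Fin n with ab.1 < ab.2,
      -P.p (min ab.1 ab.2) (max ab.1 ab.2) := by
    rw [Finset.prod_filter, Fintype.prod_prod_type]
    refine Finset.prod_congr rfl fun i _ => ?_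
    rw [← Finset.prod_filter]
    refine Finset.prod_congr (by ext; simp) fun j hj => ?_
    have : i < j := by simpa using hj
    simp [this.le]
  have h2 : invWeight P.p (σ ∘ Fin.rev) = ∏ ab : Fin n × Fin n with ab.1 < ab.2,
      if σ ab.1 < σ ab.2 then -P.p (σ ab.1) (σ ab.2) else 1 := by
    rw [invWeight, ← Finset.prod_filter, Finset.filter_filter]
    refine Finset.prod_nbij' (fun ab => (ab.2.rev, ab.1.rev)) (fun ab => (ab.2.rev, ab.1.rev))
      ?_ ?_ ?_ ?_ ?_
    all_goals simp
  rw [h1, ← prod_lt_comp_perm (fun i j => -P.p (min i j) (max i j))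
    (fun i j => by rw [min_comm, max_comm]) σ, h2, invWeight,
    ← Finset.filter_filter, Finset.prod_filter (fun ab : Fin n × Fin n => σ ab.2 < σ ab.1),
    ← Finset.prod_mul_distrib]
  refine Finset.prod_congr rfl fun ab h => ?_
  have h : ab.1 < ab.2 := by simpa using h
  -- A non-inversion contributes `-p` to both sides; an inversion contributes `1` on the left and
  -- `(-p)(-p⁻¹) = 1` on the right.
  rcases lt_or_gt_of_ne (σ.injective.ne h.ne) with h' | h'
  · simp [h', h'.le, h'.not_gt]
  · simp [h', h'.le, h'.not_gt, P.p_ne]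

end FirstValue

/-! ### The antipode matrix -/

section Antipode

variable {n : ℕ} {A : Type*} [Ring A] [Algebra ℂ A]

theorem deleteIdx_eq (i : Fin (n + 1)) : deleteIdx i = i.succAbove :=
  (Finset.orderEmbOfFin_unique _ (fun x => by simp)
    (Fin.strictMono_succAbove i)).symm

/-- Laplace expansion along the first row. -/
theorem rowDet_cons (q : Fin (n + 1) → Fin (n + 1) → ℂ) (T : Matrix (Fin (n + 1)) (Fin (n + 1)) A)
    (i : Fin (n + 1)) (r : Fin n → Fin (n + 1)) :
    rowDet q T (Fin.cons i r : Fin (n + 1) → Fin (n + 1)) =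
      ∑ j, (∏ l ∈ Finset.Iio j, -q l j) • (T i j * minor q T r j.succAbove) := by
  rw [rowDet, sum_perm_succ]
  refine Finset.sum_congr rfl fun j _ => ?_
  rw [minor, Finset.mul_sum, Finset.smul_sum]
  refine Finset.sum_congr rfl fun σ _ => ?_
  rw [invWeight_consPerm, List.ofFn_succ, List.prod_cons, mul_smul_comm, smul_smul]
  simp only [coe_consPerm, Fin.cons_zero, Fin.cons_succ, Function.comp_apply]
  rfl

theorem prod_neg_Iio (q : Fin n → Fin n → ℂ) (j : Fin n) :
    ∏ l ∈ Finset.Iio j, -q l j = (-1) ^ (j : ℕ) * ∏ l ∈ Finset.Iio j, q l j := by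
  rw [Finset.prod_neg, Fin.card_Iio]

/-- The matrix `S(T)` is a right inverse of `T`. -/
theorem T_mul_antipodeMat (P : Param n) : QGL.T P * antipodeMat P = 1 := by
  cases n with
  | zero => ext i; exact i.elim0
  | succ m =>
    ext i k
    have hq : ∀ k : Fin (m + 1), ∏ l ∈ Finset.Iio k, P.q l k ≠ 0 := fun k =>
      Finset.prod_ne_zero_iff.2 fun l _ => P.q_ne l k
    -- Up to normalization, row `i` of `T` times column `k` of `S(T)` is the Laplace expansion of
    -- the determinant whose rows are `i` followed by all rows other than `k`.
    have key : (QGL.T P * antipodeMat P) i k = (∏ l ∈ Finset.Iio k, -P.q l k)⁻¹ •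
        (rowDet P.q (QGL.T P) (Fin.cons i k.succAbove : Fin (m + 1) → Fin (m + 1)) *
          QGL.detInv P) := by
      rw [Matrix.mul_apply, rowDet_cons, Finset.sum_mul, Finset.smul_sum]
      refine Finset.sum_congr rfl fun j _ => ?_
      rw [antipodeMat, Matrix.of_apply, deleteIdx_eq, deleteIdx_eq, mul_smul_comm, smul_mul_assoc,
        smul_smul, mul_assoc]
      congr 1
      rw [prod_neg_Iio, prod_neg_Iio, pow_add, mul_inv, ← inv_pow]
      norm_num
      field_simp [hq k]
    rw [key]
    by_cases h : i = k
    · subst h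
      -- For `i = k` the rows are those of `T` in the order given by a permutation, whose weight is
      -- exactly the normalizing factor.
      have : (Fin.cons i i.succAbove : Fin (m + 1) → Fin (m + 1)) = consPerm i 1 := rfl
      rw [this, rowDet_perm (QGL.RTT_T P), invWeight_consPerm]
      have h1 : invWeight P.q (i.succAbove ∘ (1 : Equiv.Perm (Fin m))) = 1 := by
        rw [invWeight, Finset.prod_eq_one]
        intro ab h
        simp only [Finset.mem_filter] at h
        exact absurd h.2.1 (Fin.succAbove_lt_succAbove_iff.1 h.2.2).not_gt
      have h2 : ∏ l ∈ Finset.Iio i, -P.q l i ≠ 0 := by rw [prod_neg_Iio]; simp [hq]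
      rw [h1, mul_one, smul_mul_assoc, smul_smul, inv_mul_cancel₀ h2, one_smul, Matrix.one_apply_eq]
      exact QGL.detq_mul_detInv P
    -- For `i ≠ k` row `i` occurs twice.
    · rw [rowDet_not_injective (QGL.RTT_T P), zero_mul, smul_zero, Matrix.one_apply_ne h]
      intro hinj
      obtain ⟨x, hx⟩ := Fin.exists_succAbove_eq h
      exact (Fin.succ_ne_zero x) (hinj (by simp [hx]))

end Antipode

/-! ### The column determinant -/

section ColumnDet

variable {n : ℕ} {A : Type*} [Ring A] [Algebra ℂ A]

/-- Interchanging `p` and `q` swaps the arguments of `Dp`, so the relation for the transpose at `(a,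
b, c, d)` is the original one at `(d, c, b, a)` read from right to left. Hence the theory of row
determinants applies to the column determinant `det_p(T)`. -/
theorem Param.RTT.transpose {P : Param n} {T : Matrix (Fin n) (Fin n) A} (hT : P.RTT T) :
    P.flip.RTT T.transpose := by
  rw [Param.RTT_iff'] at hT ⊢
  have hD : ∀ a b, P.flip.Dp a b = P.Dp b a := by
    intro a b
    simp only [Param.Dp, Param.flip]
    rcases lt_trichotomy a b with h | h | h
    · simp [h.ne, h.ne', h, h.not_gt]
    · simp [h]
    · simp [h.ne, h.ne', h, h.not_gt]
  intro a b c d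
  have := hT d c b a
  simp only [hD, Matrix.transpose_apply, show P.flip.hp = P.hp from rfl]
  exact this.symm

end ColumnDet

/-! ### The actions on products -/

section Actions

variable {n : ℕ}

theorem leftAct_smul_sub (P : Param n) (r s : ℂ) (a b : UR P) :
    leftAct P (r • a - s • b) = r • leftAct P a - s • leftAct P b := by
  ext φ
  simp only [leftAct, map_sub, map_smul, WithConv.ofConv_sub, WithConv.ofConv_smul,
    LinearMap.lTensor_sub, LinearMap.lTensor_smul, LinearMap.comp_apply, LinearMap.sub_apply,
    LinearMap.smul_apply]

/-- The right action as a linear map. -/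
noncomputable def rightActHom (P : Param n) : UR P →ₗ[ℂ] Module.End ℂ (QGL P) where
  toFun := rightAct P
  map_add' a b := by
    ext φ
    simp only [rightAct, map_add, WithConv.ofConv_add, LinearMap.rTensor_add,
      LinearMap.comp_apply, LinearMap.add_apply]
  map_smul' r a := by
    ext φ
    simp only [rightAct, map_smul, WithConv.ofConv_smul, LinearMap.rTensor_smul,
      LinearMap.comp_apply, LinearMap.smul_apply, RingHom.id_apply]

theorem rightActHom_apply (P : Param n) (a : UR P) : rightActHom P a = rightAct P a := rfl

/-- By coassociativity `φ.(ab) = (φ.a).b`, so operators compose in the opposite order. The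
decreasing products in `cElem` thereby become increasing products of operators. -/
theorem rightAct_mul (P : Param n) (a b : UR P) :
    rightAct P (a * b) = rightAct P b * rightAct P a := by
  set f := (pairing P a).ofConv with hf
  set g := (pairing P b).ofConv with hg
  have hab : (pairing P (a * b)).ofConv =
      LinearMap.mul' ℂ ℂ ∘ₗ TensorProduct.map f g ∘ₗ Coalgebra.comul := by
    rw [map_mul]; rfl
  ext φ
  have key : ∀ y : QGL P ⊗[ℂ] (QGL P ⊗[ℂ] QGL P),
      TensorProduct.lid ℂ (QGL P) (LinearMap.rTensor (QGL P)
        (LinearMap.mul' ℂ ℂ ∘ₗ TensorProduct.map f g)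
        ((TensorProduct.assoc ℂ (QGL P) (QGL P) (QGL P)).symm y)) =
      TensorProduct.lid ℂ (QGL P) (LinearMap.rTensor (QGL P) g
        (TensorProduct.lid ℂ _ (LinearMap.rTensor (QGL P ⊗[ℂ] QGL P) f y))) := by
    intro y
    induction y using TensorProduct.induction_on with
    | zero => simp
    | add x y hx hy => simp only [map_add, hx, hy]
    | tmul x y =>
      induction y using TensorProduct.induction_on with
      | zero => simp
      | add x y hx hy => simp only [map_add, TensorProduct.tmul_add, hx, hy]
      | tmul y z =>
        simp [TensorProduct.smul_tmul', mul_smul, smul_comm (f x)]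
  have h2 : ∀ y : QGL P ⊗[ℂ] QGL P,
      Coalgebra.comul (R := ℂ) (TensorProduct.lid ℂ _ (LinearMap.rTensor (QGL P) f y)) =
      TensorProduct.lid ℂ _ (LinearMap.rTensor (QGL P ⊗[ℂ] QGL P) f
        (LinearMap.lTensor (QGL P) Coalgebra.comul y)) := by
    intro y
    induction y using TensorProduct.induction_on with
    | zero => simp
    | add x y hx hy => simp only [map_add, hx, hy]
    | tmul x y => simp
  show TensorProduct.lid ℂ _ (LinearMap.rTensor (QGL P) (pairing P (a * b)).ofConv
      (Coalgebra.comul φ)) = TensorProduct.lid ℂ _ (LinearMap.rTensor (QGL P) g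
        (Coalgebra.comul (TensorProduct.lid ℂ _ (LinearMap.rTensor (QGL P) f
          (Coalgebra.comul φ)))))
  rw [h2, ← key, Coalgebra.coassoc_symm_apply, hab, ← LinearMap.comp_assoc,
    LinearMap.rTensor_comp, LinearMap.comp_apply]

theorem rightAct_one (P : Param n) : rightAct P 1 = 1 := by
  ext φ
  show TensorProduct.lid ℂ _ (LinearMap.rTensor (QGL P) (pairing P 1).ofConv
      (Coalgebra.comul φ)) = φ
  have : (pairing P 1).ofConv = Coalgebra.counit := by
    rw [map_one]
    ext φ
    rfl
  rw [this, Coalgebra.rTensor_counit_comul]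
  simp

theorem rightAct_list_prod_reverse (P : Param n) (l : List (UR P)) :
    rightAct P l.reverse.prod = (l.map (rightAct P)).prod := by
  induction l with
  | nil => exact rightAct_one P
  | cons a l ih => simp [rightAct_mul, ih]

/-- Intertwining relations of algebra maps may be checked on the `t_ij`, also for elements that are
not invertible. -/
theorem QGL.intertwine_of_T {A : Type*} [Ring A] [Algebra ℂ A] {P : Param n} {f g : QGL P →ₐ[ℂ] A}
    {r : A} (h : ∀ i j, r * f (QGL.T P i j) = g (QGL.T P i j) * r) (φ : QGL P) :
    r * f φ = g φ * r := by
  let S : Subalgebra ℂ (QGL P) :=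
    { carrier := {φ | r * f φ = g φ * r}
      mul_mem' := fun {a b} ha hb => by
        simp only [Set.mem_ofPred_eq] at ha hb ⊢
        rw [map_mul, map_mul, ← mul_assoc, ha, mul_assoc, hb, mul_assoc]
      add_mem' := fun {a b} ha hb => by
        simp only [Set.mem_ofPred_eq] at ha hb ⊢
        rw [map_add, map_add, mul_add, ha, hb, add_mul]
      algebraMap_mem' := fun c => by
        simp only [Set.mem_ofPred_eq, AlgHom.commutes]
        exact (Algebra.commutes c r).symm }
  have hd : QGL.detq P ∈ S := by
    refine S.sum_mem fun σ _ => S.smul_mem (S.list_prod_mem ?_) _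
    intro x hx
    obtain ⟨i, rfl⟩ := (List.mem_ofFn' _ _).1 hx
    exact h _ _
  -- Multiplying `r f(det) = g(det) r` by the inverses of `g(det)` and `f(det)` on the outer sides
  -- gives the relation for `det⁻¹`.
  have hi : QGL.detInv P ∈ S := by
    have hd' : r * f (QGL.detq P) = g (QGL.detq P) * r := hd
    show r * f (QGL.detInv P) = g (QGL.detInv P) * r
    calc r * f (QGL.detInv P) = g (QGL.detInv P * QGL.detq P) * r * f (QGL.detInv P) := by
          rw [QGL.detInv_mul_detq, map_one, one_mul]
      _ = g (QGL.detInv P) * (r * f (QGL.detq P)) * f (QGL.detInv P) := by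
          rw [hd', map_mul]; simp only [mul_assoc]
      _ = g (QGL.detInv P) * r * f (QGL.detq P * QGL.detInv P) := by
          rw [map_mul]; simp only [mul_assoc]
      _ = _ := by rw [QGL.detq_mul_detInv, map_one, mul_one]
  show φ ∈ S
  obtain ⟨y, rfl⟩ := RingQuot.mkAlgHom_surjective ℂ (QGLRel P) φ
  show QGL.mk P y ∈ S
  induction y with
  | grade0 r => rw [AlgHom.commutes]; exact S.algebraMap_mem r
  | grade1 x =>
    rcases x with _ | ⟨i, j⟩
    · exact hi
    · exact h i j
  | mul a b ha hb => rw [map_mul]; exact S.mul_mem ha hb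
  | add a b ha hb => rw [map_add]; exact S.add_mem ha hb

variable {P : Param n} (f : QGL P →ₐ[ℂ] Matrix (Fin n) (Fin n) ℂ)

theorem commute_scalar_ofId (x : QGL P) (M : Matrix (Fin n) (Fin n) ℂ) :
    Commute (Matrix.scalarAlgHom (Fin n) ℂ x) ((Algebra.ofId ℂ (QGL P)).mapMatrix M) :=
  Matrix.ext fun i j => by
    simpa [Matrix.scalar_apply, Matrix.diagonal_mul, Matrix.mul_diagonal, Algebra.ofId_apply] using
      (Algebra.commutes (M i j) x).symm

/-- The algebra map `φ ↦ (l_ij.φ)` where `f(φ) = ((l_ij, φ))`. -/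
noncomputable def leftMat : QGL P →ₐ[ℂ] Matrix (Fin n) (Fin n) (QGL P) :=
  (Algebra.TensorProduct.lift (Matrix.scalarAlgHom (Fin n) ℂ)
    ((Algebra.ofId ℂ (QGL P)).mapMatrix.comp f) (fun x y => commute_scalar_ofId x (f y))).comp
      (QGL.comulHom P)

/-- The algebra map `φ ↦ (φ.l_ij)` where `f(φ) = ((l_ij, φ))`. -/
noncomputable def rightMat : QGL P →ₐ[ℂ] Matrix (Fin n) (Fin n) (QGL P) :=
  (Algebra.TensorProduct.lift ((Algebra.ofId ℂ (QGL P)).mapMatrix.comp f)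
    (Matrix.scalarAlgHom (Fin n) ℂ) (fun x y => (commute_scalar_ofId y (f x)).symm)).comp
      (QGL.comulHom P)

theorem leftMat_apply (φ : QGL P) (i j : Fin n) : leftMat f φ i j =
    TensorProduct.rid ℂ (QGL P) (LinearMap.lTensor (QGL P) (entryFun f i j).ofConv
      (Coalgebra.comul φ)) := by
  show (Algebra.TensorProduct.lift (Matrix.scalarAlgHom (Fin n) ℂ)
    ((Algebra.ofId ℂ (QGL P)).mapMatrix.comp f) (fun x y => commute_scalar_ofId x (f y)))
    (QGL.comulHom P φ) i j = TensorProduct.rid ℂ (QGL P) (LinearMap.lTensor (QGL P) _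
      (QGL.comulHom P φ))
  induction QGL.comulHom P φ using TensorProduct.induction_on with
  | zero => simp
  | add x y hx hy => simp only [map_add, Matrix.add_apply, hx, hy]
  | tmul x y =>
    show (Matrix.scalarAlgHom (Fin n) ℂ x * (Algebra.ofId ℂ (QGL P)).mapMatrix (f y) :
      Matrix (Fin n) (Fin n) (QGL P)) i j = _
    simp [Matrix.scalar_apply, Matrix.diagonal_mul, Algebra.ofId_apply, entryFun,
      Algebra.smul_def, Algebra.commutes]

theorem rightMat_apply (φ : QGL P) (i j : Fin n) : rightMat f φ i j =
    TensorProduct.lid ℂ (QGL P) (LinearMap.rTensor (QGL P) (entryFun f i j).ofConv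
      (Coalgebra.comul φ)) := by
  show (Algebra.TensorProduct.lift ((Algebra.ofId ℂ (QGL P)).mapMatrix.comp f)
    (Matrix.scalarAlgHom (Fin n) ℂ) (fun x y => (commute_scalar_ofId y (f x)).symm))
    (QGL.comulHom P φ) i j = TensorProduct.lid ℂ (QGL P) (LinearMap.rTensor (QGL P) _
      (QGL.comulHom P φ))
  induction QGL.comulHom P φ using TensorProduct.induction_on with
  | zero => simp
  | add x y hx hy => simp only [map_add, Matrix.add_apply, hx, hy]
  | tmul x y =>
    show ((Algebra.ofId ℂ (QGL P)).mapMatrix (f x) * Matrix.scalarAlgHom (Fin n) ℂ y :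
      Matrix (Fin n) (Fin n) (QGL P)) i j = _
    simp [Matrix.scalar_apply, Matrix.mul_diagonal, Algebra.ofId_apply, entryFun,
      Algebra.smul_def]

theorem leftMat_T (a b i j : Fin n) :
    leftMat f (QGL.T P a b) i j = ∑ c, f (QGL.T P c b) i j • QGL.T P a c := by
  rw [leftMat_apply]
  show TensorProduct.rid ℂ (QGL P) (LinearMap.lTensor (QGL P) _ (QGL.comulHom P _)) = _
  simp [QGL.comulHom_T, entryFun]

theorem rightMat_T (a b i j : Fin n) :
    rightMat f (QGL.T P a b) i j = ∑ c, f (QGL.T P a c) i j • QGL.T P c b := by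
  rw [rightMat_apply]
  show TensorProduct.lid ℂ (QGL P) (LinearMap.rTensor (QGL P) _ (QGL.comulHom P _)) = _
  simp [QGL.comulHom_T, entryFun]

theorem leftAct_Lplus (φ : QGL P) (i j : Fin n) :
    leftAct P (Lplus P i j) φ = leftMat (pairPlus P) φ i j := by
  rw [leftMat_apply, ← pairing_Lplus]; rfl

theorem leftAct_Lminus (φ : QGL P) (i j : Fin n) :
    leftAct P (Lminus P i j) φ = leftMat (pairMinus P) φ i j := by
  rw [leftMat_apply, ← pairing_Lminus]; rfl

theorem rightAct_Lplus (φ : QGL P) (i j : Fin n) :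
    rightAct P (Lplus P i j) φ = rightMat (pairPlus P) φ i j := by
  rw [rightMat_apply, ← pairing_Lplus]; rfl

theorem rightAct_Lminus (φ : QGL P) (i j : Fin n) :
    rightAct P (Lminus P i j) φ = rightMat (pairMinus P) φ i j := by
  rw [rightMat_apply, ← pairing_Lminus]; rfl

/-- `T (L^±.φ) = (φ.L^±) T`, provided that it holds for the entries of `T`. -/
theorem T_mul_leftMat {D h : Fin n → Fin n → ℂ}
    (hf : ∀ i j k l, f (QGL.T P i j) k l = xm D h (k, i) (l, j))
    (hD : ∀ a b c d, D a b • (QGL.T P b d * QGL.T P a c) + h a b • (QGL.T P a d * QGL.T P b c) =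
      D c d • (QGL.T P a c * QGL.T P b d) + h d c • (QGL.T P a d * QGL.T P b c))
    (φ : QGL P) : QGL.T P * leftMat f φ = rightMat f φ * QGL.T P := by
  -- Here `r = T`, for which a right inverse alone is available; hence the version of the principle
  -- without invertibility.
  refine QGL.intertwine_of_T (fun b d => ?_) φ
  ext a c
  have e1 : ∀ k l a b, ∑ c, f (QGL.T P c b) k l • QGL.T P a c =
      ∑ c, xm D h (k, c) (l, b) • QGL.T P a c := by intro k l a b; simp only [hf]
  have e2 : ∀ k l a b, ∑ c, f (QGL.T P a c) k l • QGL.T P c b =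
      ∑ c, xm D h (k, a) (l, c) • QGL.T P c b := by intro k l a b; simp only [hf]
  simp only [Matrix.mul_apply, leftMat_T, rightMat_T, e1, e2, Finset.mul_sum, Finset.sum_mul,
    mul_smul_comm, smul_mul_assoc]
  rw [sum_xm_smul' D h c d (fun x y => QGL.T P a x * QGL.T P b y),
    sum_xm_smul D h a b (fun x y => QGL.T P y d * QGL.T P x c)]
  exact (hD a b c d).symm

end Actions

/-! ### Commutation relations -/

section Commutation

variable {n : ℕ} (P : Param n)

/-- Because `R⁺` is `R` conjugated by the flip, the required relation is `RTT = TTR` with the two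
tensor factors exchanged. -/
theorem T_mul_leftMat_pairPlus (φ : QGL P) :
    QGL.T P * leftMat (pairPlus P) φ = rightMat (pairPlus P) φ * QGL.T P := by
  refine T_mul_leftMat (D := fun a b => P.Dp b a) (h := fun a b => P.hp b a) _
    (fun i j k l => by rw [pairPlus_T, P.Rplus_eq]) (fun a b c d => ?_) φ
  exact (P.RTT_iff' _).1 (QGL.RTT_T P) b a d c

theorem T_mul_leftMat_pairMinus (φ : QGL P) :
    QGL.T P * leftMat (pairMinus P) φ = rightMat (pairMinus P) φ * QGL.T P := by
  refine T_mul_leftMat (D := P.Dm) (h := P.hm) _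
    (fun i j k l => by rw [pairMinus_T, P.Rminus_eq]) (fun a b c d => ?_) φ
  -- This is the Hecke relation `R⁻ = R⁺ - (u - u⁻¹) P` with `P` the flip. For `a = b` the diagonal
  -- and flip terms coincide, hence the assumption `X = Y` there. The correction term is the same on
  -- both sides, so the case of `R⁺` suffices.
  have key : ∀ a b : Fin n, ∀ X Y : QGL P, (a = b → X = Y) → P.Dm a b • X + P.hm a b • Y =
      P.Dp b a • X + P.hp b a • Y - (P.u - P.u⁻¹) • Y := by
    intro a b X Y h
    rcases lt_trichotomy a b with h' | h' | h'
    · rw [P.Dm_lt h', P.hm_lt h', P.Dp_gt h', P.hp_gt h']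
      module
    · subst h'
      rw [P.Dm_self, P.hm_self, P.Dp_self, P.hp_self, h rfl]
      module
    · rw [P.Dm_gt h', P.hm_gt h', P.Dp_lt h', P.hp_lt h']
      module
  have key' : ∀ c d : Fin n, ∀ X Y : QGL P, (c = d → X = Y) → P.Dm c d • X + P.hm d c • Y =
      P.Dp d c • X + P.hp c d • Y - (P.u - P.u⁻¹) • Y := by
    intro c d X Y h
    rcases lt_trichotomy c d with h' | h' | h'
    · rw [P.Dm_lt h', P.hm_gt h', P.Dp_gt h', P.hp_lt h']
      module
    · subst h'
      rw [P.Dm_self, P.hm_self, P.Dp_self, P.hp_self, h rfl]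
      module
    · rw [P.Dm_gt h', P.hm_lt h', P.Dp_lt h', P.hp_gt h']
      module
  rw [key _ _ _ _ (by rintro rfl; rfl), key' _ _ _ _ (by rintro rfl; rfl),
    (P.RTT_iff' _).1 (QGL.RTT_T P) b a d c]

/-- The operators `φ ↦ φ.L_ij(s)`. -/
noncomputable def Lright (s : ℂ) (i j : Fin n) : Module.End ℂ (QGL P) :=
  rightAct P (Lmat P s i j)

theorem Lright_eq (s : ℂ) (i j : Fin n) : Lright P s i j =
    s • rightAct P (Lplus P i j) - s⁻¹ • rightAct P (Lminus P i j) := by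
  simp only [Lright, ← rightActHom_apply, Lmat, Matrix.sub_apply, Matrix.smul_apply, map_sub,
    map_smul]

/-- `φ.L(s) = T (L(s).φ) S(T)`. -/
theorem Lright_eq_sum (s : ℂ) (i j : Fin n) : Lright P s i j =
    ∑ k, LinearMap.mulLeft ℂ (QGL.T P i k) * LS P s k j := by
  ext φ
  have h1 : (s • rightMat (pairPlus P) φ - s⁻¹ • rightMat (pairMinus P) φ) =
      QGL.T P * ((s • leftMat (pairPlus P) φ - s⁻¹ • leftMat (pairMinus P) φ) * antipodeMat P) := by
    rw [← mul_assoc, mul_sub, mul_smul_comm, mul_smul_comm, T_mul_leftMat_pairPlus,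
      T_mul_leftMat_pairMinus, sub_mul, smul_mul_assoc, smul_mul_assoc, mul_assoc, mul_assoc,
      T_mul_antipodeMat, mul_one, mul_one]
  have h2 := congrArg (fun M : Matrix (Fin n) (Fin n) (QGL P) => M i j) h1
  simp only [Matrix.sub_apply, Matrix.smul_apply, Matrix.mul_apply] at h2
  simp only [Lright_eq, LinearMap.sub_apply, LinearMap.smul_apply, rightAct_Lplus, rightAct_Lminus,
    h2, LinearMap.sum_apply, Module.End.mul_apply, LinearMap.mulLeft_apply, LS, Matrix.of_apply,
    LinearMap.mulRight_apply, Lmat, Matrix.sub_apply, Matrix.smul_apply, leftAct_smul_sub,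
    leftAct_Lplus, leftAct_Lminus]

/-- Multiplicativity of `rightMat` gives `(t_ab φ).l_ij = ∑_k (t_ab.l_ik)(φ.l_kj)`, and `(l⁺_ik,
t_ac)` is an entry of `R⁺`. Its shape leaves only a diagonal and a flipped term. -/
theorem rightAct_Lplus_mul_T (i j a b : Fin n) :
    rightAct P (Lplus P i j) * LinearMap.mulLeft ℂ (QGL.T P a b) =
      P.Dp a i • (LinearMap.mulLeft ℂ (QGL.T P a b) * rightAct P (Lplus P i j)) +
      P.hp a i • (LinearMap.mulLeft ℂ (QGL.T P i b) * rightAct P (Lplus P a j)) := by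
  ext φ
  have h := sum_xm_smul (fun a b => P.Dp b a) (fun a b => P.hp b a) i a
    (fun k c => QGL.T P c b * rightMat (pairPlus P) φ k j)
  simp only [Module.End.mul_apply, LinearMap.mulLeft_apply, LinearMap.add_apply,
    LinearMap.smul_apply, rightAct_Lplus, map_mul, Matrix.mul_apply, rightMat_T, pairPlus_T,
    P.Rplus_eq, Finset.sum_mul, smul_mul_assoc]
  exact h

theorem rightAct_Lminus_mul_T (i j a b : Fin n) :
    rightAct P (Lminus P i j) * LinearMap.mulLeft ℂ (QGL.T P a b) =
      P.Dm i a • (LinearMap.mulLeft ℂ (QGL.T P a b) * rightAct P (Lminus P i j)) +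
      P.hm i a • (LinearMap.mulLeft ℂ (QGL.T P i b) * rightAct P (Lminus P a j)) := by
  ext φ
  have h := sum_xm_smul P.Dm P.hm i a
    (fun k c => QGL.T P c b * rightMat (pairMinus P) φ k j)
  simp only [Module.End.mul_apply, LinearMap.mulLeft_apply, LinearMap.add_apply,
    LinearMap.smul_apply, rightAct_Lminus, map_mul, Matrix.mul_apply, rightMat_T, pairMinus_T,
    P.Rminus_eq, Finset.sum_mul, smul_mul_assoc]
  exact h

variable {P}

theorem Param.p_inv (i j : Fin n) : P.p j i = (P.p i j)⁻¹ :=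
  eq_inv_of_mul_eq_one_right (P.p_mul_p i j)

/-- In antisymmetrized form, moving `T` to the left past `φ ↦ φ.L(su)` shifts the parameter. -/
theorem Lright_mul_T {s : ℂ} (hs : s ≠ 0) (c b i j : Fin n) (hij : i ≠ j) :
    Lright P (s * P.u) i c * LinearMap.mulLeft ℂ (QGL.T P j b) -
        P.p i j • (Lright P (s * P.u) j c * LinearMap.mulLeft ℂ (QGL.T P i b)) =
      (-1 : ℂ) • (LinearMap.mulLeft ℂ (QGL.T P i b) * Lright P s j c -
        P.p i j • (LinearMap.mulLeft ℂ (QGL.T P j b) * Lright P s i c)) := by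
  have hu := P.u_ne_zero
  -- Since `p_ji = p_ij⁻¹`, multiplication by `-p_ij` turns the statement for `(j, i)` into that for
  -- `(i, j)`.
  wlog h : i < j generalizing i j
  · have := this j i hij.symm (lt_of_le_of_ne (not_lt.1 h) hij.symm)
    have hp := P.p_ne i j
    rw [Param.p_inv i j] at this
    linear_combination (norm := (match_scalars <;> field_simp <;> ring)) (-P.p i j) • this
  have hp := P.p_ne i j
  simp only [Lright_eq, sub_mul, mul_sub, smul_mul_assoc, mul_smul_comm, rightAct_Lplus_mul_T,
    rightAct_Lminus_mul_T, P.Dp_gt h, P.Dp_lt h, P.hp_gt h, P.hp_lt h, P.Dm_lt h, P.Dm_gt h,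
    P.hm_gt h, P.hm_lt h]
  -- In this antisymmetric combination the exchange multiplies the `L⁺` part by `-u⁻¹` and the `L⁻`
  -- part by `-u`; together with the coefficients `su` and `(su)⁻¹` this produces `-L(s)`.
  match_scalars <;> field_simp <;> ring

end Commutation

/-! ### Antisymmetry of products of `L(s)` and `L(su)` -/

section URelations

variable {n : ℕ} {P : Param n}

theorem Rplus_rel {A : Type*} [Ring A] [Algebra ℂ A] (S T : Matrix (Fin n) (Fin n) A)
    (a b c d : Fin n) (h : ∑ x, ∑ y, P.Rplus (a, b) (x, y) • (S x c * T y d) =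
      ∑ x, ∑ y, P.Rplus (x, y) (c, d) • (T b y * S a x)) :
    P.Dp b a • (S a c * T b d) + P.hp b a • (S b c * T a d) =
      P.Dp d c • (T b d * S a c) + P.hp c d • (T b c * S a d) := by
  rw [P.Rplus_eq, sum_xm_smul (A := A) (fun a b => P.Dp b a) (fun a b => P.hp b a) a b
      (fun x y => S x c * T y d),
    sum_xm_smul' (A := A) (fun a b => P.Dp b a) (fun a b => P.hp b a) c d
      (fun x y => T b y * S a x)] at h
  exact h

theorem Lplus_rel (a b c d : Fin n) :
    P.Dp b a • (Lplus P a c * Lplus P b d) + P.hp b a • (Lplus P b c * Lplus P a d) =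
      P.Dp d c • (Lplus P b d * Lplus P a c) + P.hp c d • (Lplus P b c * Lplus P a d) := by
  refine Rplus_rel (Lplus P) (Lplus P) a b c d ?_
  have := RingQuot.mkAlgHom_rel ℂ (URel.pp (P := P) (a, b) (c, d))
  rw [map_mul_leg, leg_mul_map] at this
  simp only [map_sum, map_smul, map_mul] at this
  exact this

theorem Lminus_rel (a b c d : Fin n) :
    P.Dp b a • (Lminus P a c * Lminus P b d) + P.hp b a • (Lminus P b c * Lminus P a d) =
      P.Dp d c • (Lminus P b d * Lminus P a c) + P.hp c d • (Lminus P b c * Lminus P a d) := by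
  refine Rplus_rel (Lminus P) (Lminus P) a b c d ?_
  have := RingQuot.mkAlgHom_rel ℂ (URel.mm (P := P) (a, b) (c, d))
  rw [map_mul_leg, leg_mul_map] at this
  simp only [map_sum, map_smul, map_mul] at this
  exact this

theorem Lplus_Lminus_rel (a b c d : Fin n) :
    P.Dp b a • (Lplus P a c * Lminus P b d) + P.hp b a • (Lplus P b c * Lminus P a d) =
      P.Dp d c • (Lminus P b d * Lplus P a c) + P.hp c d • (Lminus P b c * Lplus P a d) := by
  refine Rplus_rel (Lplus P) (Lminus P) a b c d ?_
  have := RingQuot.mkAlgHom_rel ℂ (URel.pm (P := P) (a, b) (c, d))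
  rw [map_mul_leg, leg_mul_map] at this
  simp only [map_sum, map_smul, map_mul] at this
  exact this

/-- Antisymmetrizing the rows of `L(s)L(su)` makes it antisymmetric in the columns. The parts
quadratic in `L⁺` or in `L⁻` follow from their own relations for any ratio of parameters; the ratio
`u` serves the mixed part, where it gives `L⁺L⁻` and `L⁻L⁺` the coefficients `-u⁻¹` and `-u`. -/
theorem Lmat_rel {s : ℂ} (hs : s ≠ 0) (i j c d : Fin n) (hij : i ≠ j) (hcd : c ≠ d) :
    Lmat P s j c * Lmat P (s * P.u) i d - P.p i j • (Lmat P s i c * Lmat P (s * P.u) j d) =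
      -P.p c d • (Lmat P s j d * Lmat P (s * P.u) i c -
        P.p i j • (Lmat P s i d * Lmat P (s * P.u) j c)) := by
  have hu := P.u_ne_zero
  wlog h : i < j generalizing i j
  · have := this j i hij.symm (lt_of_le_of_ne (not_lt.1 h) hij.symm)
    have hp := P.p_ne i j
    rw [Param.p_inv i j] at this
    linear_combination (norm := (match_scalars <;> field_simp <;> ring)) (-P.p i j) • this
  wlog h' : c < d generalizing c d
  · have := this d c hcd.symm (lt_of_le_of_ne (not_lt.1 h') hcd.symm)
    have hp := P.p_ne c d
    rw [Param.p_inv c d] at this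
    linear_combination (norm := (match_scalars <;> field_simp <;> ring)) (P.p c d) • this
  have hp := P.p_ne i j
  have hr := P.p_ne c d
  have e1 := Lplus_rel (P := P) i j c d
  have e2 := Lplus_rel (P := P) j i c d
  have e3 := Lminus_rel (P := P) i j c d
  have e4 := Lminus_rel (P := P) j i c d
  have f1 := Lplus_Lminus_rel (P := P) i j c d
  have f2 := Lplus_Lminus_rel (P := P) j i c d
  -- The mixed relation treats its two factors differently, so both orders of the columns are
  -- needed.
  have f3 := Lplus_Lminus_rel (P := P) i j d c
  have f4 := Lplus_Lminus_rel (P := P) j i d c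
  simp only [P.Dp_gt h, P.Dp_lt h, P.hp_gt h, P.hp_lt h, P.Dp_gt h', P.Dp_lt h', P.hp_gt h',
    P.hp_lt h'] at e1 e2 e3 e4 f1 f2 f3 f4
  simp only [Lmat, Matrix.sub_apply, Matrix.smul_apply, sub_mul, mul_sub, smul_mul_assoc,
    mul_smul_comm]
  linear_combination (norm := (match_scalars <;> field_simp <;> ring))
    (-(s ^ 2 * P.u ^ 2)) • e1 + (s ^ 2 * P.u ^ 2 * P.p i j) • e2 + (-(s ^ 2)⁻¹) • e3 +
    ((s ^ 2)⁻¹ * P.p i j) • e4 + f1 + (-P.p i j) • f2 + P.p c d • f3 + (-(P.p c d * P.p i j)) • f4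

/-- The image of `Lmat_rel` under the right action, which reverses the products: the larger power of
`u` now stands on the left. -/
theorem Lright_rel {s : ℂ} (hs : s ≠ 0) (i j c d : Fin n) (hij : i ≠ j) (hcd : c ≠ d) :
    Lright P (s * P.u) i d * Lright P s j c - P.p i j • (Lright P (s * P.u) j d * Lright P s i c) =
      -P.p c d • (Lright P (s * P.u) i c * Lright P s j d -
        P.p i j • (Lright P (s * P.u) j c * Lright P s i d)) := by
  have := congrArg (rightActHom P) (Lmat_rel hs i j c d hij hcd)
  simp only [map_sub, map_smul, rightActHom_apply, rightAct_mul] at this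
  exact this

end URelations

/-! ### Moving the coordinates to the left -/

section Normal

variable {n : ℕ} {A : Type*} [Ring A] [Algebra ℂ A]

/-- The last factor is the only one with nothing to its right, so a sum of products there can be
expanded with the right-hand factors `d b` pulled out of the alternating sum. -/
theorem altSum_last {q : Fin n → Fin n → ℂ} {ι : Type*} [Fintype ι] {F : ℕ → Fin n → A} {m : ℕ}
    (hm : m + 1 = n) (G : ι → ℕ → Fin n → A) (d : ι → A) (hG : ∀ b, ∀ i < m, G b i = F i)
    (hF : ∀ s, F m s = ∑ b, G b m s * d b) : altSum q F = ∑ b, altSum q (G b) * d b := by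
  subst hm
  simp only [altSum, Finset.sum_mul]
  rw [Finset.sum_comm]
  refine Finset.sum_congr rfl fun σ _ => ?_
  simp only [List.ofFn_succ', List.concat_eq_append, List.prod_append, List.prod_singleton,
    Fin.val_last, Fin.val_castSucc, hF, Finset.mul_sum, Finset.smul_sum, smul_mul_assoc, mul_assoc]
  refine Finset.sum_congr rfl fun b _ => ?_
  congr 4
  funext i
  rw [hG b i i.2]

variable (P : Param n) {t : Fin n → Fin n → A} {N : ℕ → ℕ → Fin n → A} {d : ℕ → Fin n → A}

/-- The vector `t_{·b}` moves to the left past a sequence of vectors `N`. -/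
theorem altSum_move (hN : ∀ r c b i j, i ≠ j →
      N (r + 1) c i * t j b - P.q i j • (N (r + 1) c j * t i b) =
        (-1 : ℂ) • (t i b * N r c j - P.q i j • (t j b * N r c i)))
    (F : ℕ → Fin n → A) (b : Fin n) (k m : ℕ) (hm : k + m < n) :
    altSum P.q (fun i => if i < k then F i else if i < k + m then N (n - 1 - i) (i - k)
        else if i = k + m then fun s => t s b else N (n - 1 - i) (i - k - 1)) =
      (-1 : ℂ) ^ m • altSum P.q (fun i => if i < k then F i
        else if i = k then fun s => t s b else N (n - 1 - i) (i - (k + 1))) := by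
  induction m with
  | zero =>
    rw [pow_zero, one_smul]
    refine altSum_congr fun i _ j => ?_
    by_cases h : i < k
    · simp [h]
    · simp [h, Nat.sub_sub]
  | succ m ih =>
    -- In position `i` the first argument of `N` is always `n - 1 - i`. When `t` passes, a factor
    -- moves one place to the right and keeps its column, so this argument must drop by one, as `hN`
    -- provides.
    rw [pow_succ', mul_smul, ← ih (by omega)]
    refine altSum_adjacent P (k + m) (by omega) (fun x hx hx' => ?_) _ (fun i j hij => ?_)
    · have e1 : (x < k + (m + 1)) = (x < k + m) := by
        apply propext; omega
      simp only [e1, if_neg hx, show x ≠ k + (m + 1) from hx', if_false]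
    · have e : n - 1 - (k + m) = n - 1 - (k + m + 1) + 1 := by omega
      simp only [show ¬ k + m < k by omega, show k + m < k + (m + 1) by omega,
        show ¬ k + (m + 1) < k + (m + 1) by omega,
        show k + m + 1 = k + (m + 1) from rfl, show ¬ k + m < k + m by omega,
        show ¬ k + (m + 1) < k + m by omega, show k + (m + 1) ≠ k + m by omega,
        show ¬ k + (m + 1) < k by omega,
        if_true, if_false, e, show k + m - k = m by omega, show k + (m + 1) - k - 1 = m by omega]
      exact hN _ _ _ _ _ hij

/-- Induction on the number `m` of factors still to be treated; positions below `k` hold the vectors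
already moved to the front. Treating the last of the `m` factors costs `m - 1` exchanges, which
accounts for the product of signs. The value `0` in the `dite` is never reached, since `k ≤ i < n =
k + m` forces `n - 1 - i < m`. -/
theorem altSum_normal_aux (h0 : ∀ j s, N 0 j s = ∑ b, t s b * d j b)
    (hN : ∀ r c b i j, i ≠ j →
      N (r + 1) c i * t j b - P.q i j • (N (r + 1) c j * t i b) =
        (-1 : ℂ) • (t i b * N r c j - P.q i j • (t j b * N r c i)))
    (m k : ℕ) (hk : k + m = n) (F : ℕ → Fin n → A) :
    altSum P.q (fun i => if i < k then F i else N (n - 1 - i) (i - k)) =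
      (∏ i ∈ Finset.range m, (-1 : ℂ) ^ i) • ∑ b : Fin m → Fin n,
        altSum P.q (fun i => if i < k then F i else
          if h : n - 1 - i < m then fun s => t s (b ⟨n - 1 - i, h⟩) else 0) *
        (List.ofFn fun i : Fin m => d i (b i)).prod := by
  induction m generalizing k F with
  | zero =>
    simp only [Finset.range_zero, Finset.prod_empty, one_smul, Finset.univ_unique,
      Finset.sum_singleton, List.ofFn_zero, List.prod_nil, mul_one]
    refine altSum_congr fun i hi j => ?_
    have : i < k := by omega
    simp [this]
  | succ m ih =>
    -- The last position is `n - 1 = k + m`, where the first argument of `N` is `0` and `h0`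
    -- applies.
    have h1 := altSum_last (q := P.q) (show n - 1 + 1 = n by omega)
      (F := fun i => if i < k then F i else N (n - 1 - i) (i - k))
      (fun b : Fin n => fun i => if i < k then F i else if i < k + m then N (n - 1 - i) (i - k)
        else if i = k + m then fun s => t s b else N (n - 1 - i) (i - k - 1)) (fun b => d m b)
      (fun b i hi => by simp only [show i < k + m by omega, if_true])
      (fun s => by
        simp only [show n - 1 = k + m by omega, show ¬ k + m < k by omega, lt_irrefl, if_true,
          if_false, Nat.sub_self, show k + m - k = m by omega, h0])
    rw [h1]
    have h2 : ∀ b : Fin n, altSum P.q (fun i => if i < k then F i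
        else if i = k then fun s => t s b else N (n - 1 - i) (i - (k + 1))) =
        altSum P.q (fun i => if i < k + 1 then (if i = k then fun s => t s b else F i)
          else N (n - 1 - i) (i - (k + 1))) := by
      intro b
      refine altSum_congr fun i hi j => ?_
      rcases lt_trichotomy i k with h | h | h
      · simp [h, h.ne, show i < k + 1 by omega]
      · simp [h]
      · simp [h.ne', h.not_gt, show ¬ i < k + 1 by omega]
    simp only [altSum_move P hN F _ k m (by omega), h2,
      ih (k + 1) (by omega)]
    -- The index `b` just split off belongs to the rightmost `d`, so it is appended as the last
    -- entry of the tuple.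
    rw [Finset.prod_range_succ, mul_comm (Finset.prod _ _), mul_smul,
      ← (Fin.snocEquiv fun _ => Fin n).sum_comp, Fintype.sum_prod_type]
    simp only [smul_mul_assoc, ← Finset.smul_sum, Finset.sum_mul, mul_assoc]
    congr 2
    refine Finset.sum_congr rfl fun b _ => Finset.sum_congr rfl fun b' _ => ?_
    congr 1
    · refine altSum_congr fun i hi j => ?_
      rcases lt_trichotomy i k with h | h | h
      · simp [h, h.ne, show i < k + 1 by omega]
      · have e : n - 1 - i = m := by omega
        simp [h, show n - 1 - k = m by omega, Fin.snocEquiv, Fin.snoc]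
      · have e : n - 1 - i < m := by omega
        simp [h.not_gt, show ¬ i < k + 1 by omega, e, show n - 1 - i < m + 1 by omega,
          Fin.snocEquiv, Fin.snoc]
    · rw [List.ofFn_succ']
      simp [Fin.snocEquiv]

/-- The case `k = 0`. The rightmost factor is treated first and its `t` goes to the very front, so
the columns of `t` appear in reverse order, whence `b ∘ Fin.rev`. -/
theorem altSum_normal (h0 : ∀ j s, N 0 j s = ∑ b, t s b * d j b)
    (hN : ∀ r c b i j, i ≠ j →
      N (r + 1) c i * t j b - P.q i j • (N (r + 1) c j * t i b) =
        (-1 : ℂ) • (t i b * N r c j - P.q i j • (t j b * N r c i))) :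
    altSum P.q (fun i => N (n - 1 - i) i) = (∏ i ∈ Finset.range n, (-1 : ℂ) ^ i) •
      ∑ b : Fin n → Fin n, rowDet P.q (fun i s => t s i) (b ∘ Fin.rev) *
        (List.ofFn fun i : Fin n => d i (b i)).prod := by
  have := altSum_normal_aux P h0 hN n 0 (zero_add n) 0
  simp only [Nat.not_lt_zero, if_false, Nat.sub_zero] at this
  rw [this]
  congr 1
  refine Finset.sum_congr rfl fun b _ => ?_
  congr 1
  refine Finset.sum_congr rfl fun σ _ => ?_
  congr 3
  funext i
  have : n - 1 - (i : ℕ) < n := by have := i.2; omega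
  simp only [dif_pos this, Function.comp_apply]
  congr 2
  ext
  simp only [Fin.val_rev]; omega

end Normal

/-! ### Evaluation of the Capelli element -/

section Capelli

variable {n : ℕ} {P : Param n}

/-- The vectors `L_{·τ_i}(s u^{-i})°`. -/
noncomputable def LrightCol (P : Param n) (s : ℂ) (τ : Fin n → Fin n) (i : ℕ) (j : Fin n) :
    Module.End ℂ (QGL P) :=
  if h : i < n then Lright P (s * (P.u ^ i)⁻¹) j (τ ⟨i, h⟩) else 0

/-- Neighbouring parameters have ratio `u`, so `Lright_rel` is exactly the proportionality of
quantum minors that `altSum_adjacent` asks for. The flipped parameters turn `q`-weights into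
`p`-weights. -/
theorem altSum_LrightCol_swap {m : ℕ} {P : Param (m + 1)} {s : ℂ} (hs : s ≠ 0) (a : Fin m)
    (τ : Fin (m + 1) → Fin (m + 1)) (h : τ a.castSucc ≠ τ a.succ) :
    altSum P.p (LrightCol P s (τ ∘ Equiv.swap a.castSucc a.succ)) =
      -P.p (τ a.castSucc) (τ a.succ) • altSum P.p (LrightCol P s τ) := by
  have hu := P.u_ne_zero
  refine altSum_adjacent P.flip a (by omega) (fun x hx hx' => ?_) _ (fun i j hij => ?_)
  · funext y
    simp only [LrightCol, Function.comp_apply]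
    split_ifs with hxm
    · rw [Equiv.swap_apply_of_ne_of_ne (fun e => hx (congrArg Fin.val e))
        (fun e => hx' (congrArg Fin.val e))]
    · rfl
  · have h1 : (a : ℕ) < m + 1 := by omega
    have h2 : (a : ℕ) + 1 < m + 1 := by omega
    have e : s * (P.u ^ (a : ℕ))⁻¹ = s * (P.u ^ ((a : ℕ) + 1))⁻¹ * P.u := by
      field_simp
      exact pow_succ _ _
    have e1 : (⟨a, h1⟩ : Fin (m + 1)) = a.castSucc := rfl
    have e2 : (⟨a + 1, h2⟩ : Fin (m + 1)) = a.succ := rfl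
    simp only [LrightCol, dif_pos h1, dif_pos h2, e, e1, e2, Function.comp_apply,
      Equiv.swap_apply_left, Equiv.swap_apply_right]
    exact Lright_rel (by simp [hs, hu]) i j _ _ hij h

theorem altSum_LrightCol {s : ℂ} (hs : s ≠ 0) (τ : Equiv.Perm (Fin n)) :
    altSum P.p (LrightCol P s τ) = invWeight P.p τ • altSum P.p (LrightCol P s id) := by
  have h1 : altSum P.p (LrightCol P s (1 : Equiv.Perm (Fin n))) =
      invWeight P.p (1 : Equiv.Perm (Fin n)) • altSum P.p (LrightCol P s id) := by
    rw [show ⇑(1 : Equiv.Perm (Fin n)) = fun i => i from rfl, invWeight_id, one_smul]; rfl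
  cases n with
  | zero => rw [Subsingleton.elim τ 1]; exact h1
  | succ m =>
    have hσ : τ ∈ Submonoid.closure (Set.range fun i : Fin m => Equiv.swap i.castSucc i.succ) := by
      rw [Equiv.Perm.mclosure_swap_castSucc_succ]; trivial
    induction hσ using Submonoid.closure_induction_right with
    | one => exact h1
    | mul_right τ _ s hs ih =>
      obtain ⟨a, rfl⟩ := hs
      have hne := τ.injective.ne (Fin.castSucc_lt_succ (i := a)).ne
      rw [Equiv.Perm.coe_mul, altSum_LrightCol_swap ‹_› a τ hne, ih,
        show P.p = P.flip.q from rfl, invWeight_swap P.flip a τ hne, smul_smul]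

/-- For each `τ` the sum over `σ` is `(-p)_τ` times the one for `τ = id`; the remaining scalar is
`∑_τ (-q)_τ (-p)_τ`. -/
theorem rightAct_cElem {s : ℂ} (hs : s ≠ 0) :
    rightAct P (cElem P s) = qFactorial (P.u ^ 2) n • altSum P.p (LrightCol P s id) := by
  have h1 : ∀ τ : Equiv.Perm (Fin n), ∑ σ : Equiv.Perm (Fin n),
      (invWeight P.p σ * invWeight P.q τ) • (List.ofFn fun i : Fin n =>
        Lright P (s * (P.u ^ (i : ℕ))⁻¹) (σ i) (τ i)).prod =
      (invWeight P.q τ * invWeight P.p τ) • altSum P.p (LrightCol P s id) := by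
    intro τ
    rw [mul_smul, ← altSum_LrightCol hs, altSum, Finset.smul_sum]
    refine Finset.sum_congr rfl fun σ _ => ?_
    rw [smul_smul, mul_comm]
    simp [LrightCol]
  rw [← rightActHom_apply, cElem]
  simp only [map_sum, map_smul, rightActHom_apply, rightAct_list_prod_reverse, List.map_ofFn]
  rw [Finset.sum_comm, ← sum_invWeight_p_mul_q, Finset.sum_smul]
  exact Finset.sum_congr rfl fun τ _ => h1 τ

/-- Products of left multiplications by columns of `T`, in antisymmetrized form. -/
theorem rowDet_mulLeft_T (k : Fin n → Fin n) :
    rowDet P.p (fun i s => LinearMap.mulLeft ℂ (QGL.T P s i)) k =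
      if Function.Injective k then invWeight P.p k • LinearMap.mulLeft ℂ (QGL.detp P)
      else 0 := by
  -- Left multiplication is an algebra map, so the operators given by the entries of the transpose
  -- of `T` again satisfy the relation for the flipped parameters, and their row determinant is left
  -- multiplication by `det_p(T)`.
  have hT : P.flip.RTT (((QGL.T P).transpose).map (Algebra.lmul ℂ (QGL P))) :=
    (QGL.RTT_T P).transpose.map _
  split_ifs with h
  · have := rowDet_perm hT (Equiv.ofBijective k (Finite.injective_iff_bijective.1 h))
    rw [← rdet_map] at this
    exact this
  · exact rowDet_not_injective hT k h

/-- Normal ordering with `N r c = L_{·c}(x u^r)°`, `t = T` and `d` the columns of `LS P x`: every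
derivative ends up with the same parameter `x`, because each factor is expanded only after its power
of `u` has been used up. -/
theorem altSum_LrightCol_id {x : ℂ} (hx : x ≠ 0) :
    altSum P.p (LrightCol P (x * P.u ^ (n - 1)) id) = (∏ i : Fin n, ∏ j ∈ Finset.Ioi i, P.p i j) •
      (LinearMap.mulLeft ℂ (QGL.detp P) *
        rdet (fun i j => (P.p i j)⁻¹) (LS P x).transpose) := by
  have hu := P.u_ne_zero
  have h := altSum_normal P.flip (t := fun i s => LinearMap.mulLeft ℂ (QGL.T P i s))
    (N := fun r c s => if h : c < n then Lright P (x * P.u ^ r) s ⟨c, h⟩ else 0)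
    (d := fun c b => if h : c < n then LS P x b ⟨c, h⟩ else 0)
    (fun c s => by
      by_cases h : c < n
      · simp only [h, dif_pos, pow_zero, mul_one, Lright_eq_sum]
      · simp [h])
    (fun r c b i j hij => by
      by_cases h : c < n
      · simp only [h, dif_pos, pow_succ, ← mul_assoc]
        exact Lright_mul_T (by simp [hx, hu]) _ b i j hij
      · simp [h])
  -- Starting at `x u^{n-1}` and dividing by `u^i` leaves the exponent `n - 1 - i`, the form that
  -- `altSum_normal` expects.
  have h1 : altSum P.p (LrightCol P (x * P.u ^ (n - 1)) id) = altSum P.p (fun i s =>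
      if h : i < n then Lright P (x * P.u ^ (n - 1 - i)) s ⟨i, h⟩ else 0) := by
    refine altSum_congr fun i hi s => ?_
    rw [LrightCol, dif_pos hi, dif_pos hi, mul_assoc, ← pow_sub₀ _ hu (by omega)]
    rfl
  -- The sign `(-1)^{n(n-1)/2}` from reversing a permutation is the one collected by the exchanges;
  -- by `h3` their product is `1`.
  have h2 : (∏ i : Fin n, ∏ j ∈ Finset.Ioi i, -P.p i j) =
      (∏ i ∈ Finset.range n, (-1 : ℂ) ^ i) * ∏ i : Fin n, ∏ j ∈ Finset.Ioi i, P.p i j := by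
    simp only [Finset.prod_neg, Fin.card_Ioi, Finset.prod_mul_distrib]
    rw [Fin.prod_univ_eq_prod_range (fun i => (-1 : ℂ) ^ (n - 1 - i)),
      Finset.prod_range_reflect (fun i => (-1 : ℂ) ^ i)]
  have h3 : (∏ i ∈ Finset.range n, (-1 : ℂ) ^ i) * ∏ i ∈ Finset.range n, (-1 : ℂ) ^ i = 1 := by
    rw [← Finset.prod_mul_distrib, Finset.prod_eq_one]
    intro i _
    rw [← mul_pow]; simp
  refine (h1.trans h).trans ?_
  -- Only injective `b` contribute, so the sum over all tuples reduces to permutations and becomes a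
  -- row determinant.
  rw [rdet, Finset.mul_sum, Finset.smul_sum, Finset.smul_sum,
    ← Finset.sum_subset (Finset.subset_univ (Finset.univ.map
      ⟨fun σ : Equiv.Perm (Fin n) => ⇑σ, DFunLike.coe_injective⟩))]
  · rw [Finset.sum_map]
    refine Finset.sum_congr rfl fun σ _ => ?_
    simp only [Function.Embedding.coeFn_mk]
    rw [show P.flip.q = P.p from rfl, rowDet_mulLeft_T,
      if_pos (σ.injective.comp Fin.rev_injective), invWeight_comp_rev, h2]
    simp only [smul_mul_assoc, mul_smul_comm, smul_smul, Fin.is_lt, dif_pos, Fin.eta,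
      Matrix.transpose_apply]
    congr 1
    linear_combination (∏ i : Fin n, ∏ j ∈ Finset.Ioi i, P.p i j) *
      invWeight (fun i j => (P.p i j)⁻¹) σ * h3
  · intro k _ hk
    rw [show P.flip.q = P.p from rfl, rowDet_mulLeft_T, if_neg, zero_mul, smul_zero]
    intro hinj
    have hk' : Function.Injective k := by
      have := hinj.comp Fin.rev_injective
      simpa [Function.comp_assoc, Fin.rev_involutive.comp_self] using this
    apply hk
    simp only [Finset.mem_map, Finset.mem_univ, true_and]
    exact ⟨Equiv.ofBijective k (Finite.injective_iff_bijective.1 hk'), rfl⟩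

theorem rdet_smul {A : Type*} [Ring A] [Algebra ℂ A] (q : Fin n → Fin n → ℂ) (c : ℂ)
    (X : Matrix (Fin n) (Fin n) A) : rdet q (c • X) = c ^ n • rdet q X := by
  have h : ∀ {m : ℕ} (f : Fin m → A), (List.ofFn fun i => c • f i).prod =
      c ^ m • (List.ofFn f).prod := by
    intro m f
    induction m with
    | zero => simp
    | succ m ih => simp [List.ofFn_succ, ih, smul_smul, pow_succ]
  rw [rdet, rdet, Finset.smul_sum]
  refine Finset.sum_congr rfl fun σ _ => ?_
  rw [smul_comm, ← h]
  rfl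

end Capelli

end QuantumGL

/-- The generalized quantum Capelli identity on `GL_{p,u}(n)`:
`d(x u^{n-1}) = ∏_{i<j} p_ij · det_p(T) · rdet_{p⁻¹}(∂(x))`, an identity of linear operators on
`GL_{p,u}(n)`, with `det_p(T)` acting by left multiplication. -/
theorem theorem4p6 {n : ℕ} (P : QuantumGL.Param n) (hu : P.u ^ 2 ≠ 1)
    (hfact : QuantumGL.qFactorial (P.u ^ 2) n ≠ 0) (x : ℂ) (hx : x ≠ 0) :
    QuantumGL.dOp P (x * P.u ^ (n - 1)) =
      (∏ i : Fin n, ∏ j ∈ Finset.Ioi i, P.p i j) •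
        (LinearMap.mulLeft ℂ (QuantumGL.QGL.detp P) *
          QuantumGL.rdet (fun i j => (P.p i j)⁻¹) (QuantumGL.partialMat P x)) := by
  -- The quantum factorial cancels against the normalization of `dOp`, and `(u - u⁻¹)^{-n}` appears
  -- on both sides by homogeneity of `rdet`.
  rw [QuantumGL.dOp, QuantumGL.rightAct_cElem (mul_ne_zero hx (pow_ne_zero _ P.u_ne_zero)),
    QuantumGL.altSum_LrightCol_id hx, QuantumGL.partialMat, QuantumGL.rdet_smul, smul_smul,
    mul_assoc, inv_mul_cancel₀ hfact, mul_one, inv_pow, mul_smul_comm, smul_comm]
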